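/- Let $b\in\mathbb C\setminus\{0\}$ be such that $k:=2\,\mathrm{Re}(b^2)$ is an integer, and put $t=4\pi b^2$. Denote the coordinates on $[0,1]^2$ by $(u',v')$ and consider the connection $\nabla=d+i\pi k\,(v'\,du'-u'\,dv')$, i.e. $\nabla_{u'}=\partial_{u'}+i\pi k v'$ and $\nabla_{v'}=\partial_{v'}-i\pi k u'$ (weak derivatives), together with the operators $$P_{u'}=-\tfrac{i}{t}\nabla_{v'}+u',\quad P_{u''}=-\tfrac1t\nabla_{v'},\quad P_{v'}=\tfrac{i}{\bar t}\nabla_{u'}+v',\quad P_{v''}=-\tfrac1{\bar t}\nabla_{u'},$$ $P_u=P_{u'}+iP_{u''}$, $P_{\bar u}=P_{u'}-iP_{u''}$, $P_v=P_{v'}+iP_{v''}$, $P_{\bar v}=P_{v'}-iP_{v''}$. Let $$\mathcal H'=\{s\in H^1([0,1]^2)\mid s(1,v')=e^{\pi i k v'}s(0,v'),\ s(u',1)=e^{-\pi i k u'}s(u',0)\},$$ boundary values being taken in the sense of traces, and consider in the Hilbert space $L^2([0,1]^2)$ (with its usual inner product) the unbounded operators $$q=ib\,P_u=\tfrac1{2\pi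 b}\nabla_{v'}+ib\,u',\qquad p=ib\,P_v=ib\,v',$$ $$\tilde q=i\bar b\,P_{\bar v}=-\tfrac1{2\pi\bar b}\nabla_{u'}+i\bar b\,v',\qquad \tilde p=-i\bar b\,P_{\bar u}=-i\bar b\,u'$$ with the domains $$\mathcal D(q)=\mathcal D(p)=\{s\in\mathcal H'\mid s(0,v')=0\},\qquad \mathcal D(\tilde q)=\mathcal D(\tilde p)=\{s\in\mathcal H'\mid s(u',0)=0\}.$$ Then each of the four operators is densely defined and closable, and its closure is normal (i.e. densely defined and closed, with $T^*T=TT^*$). The spectra (of the closures) are $$\sigma(q)=i(b-b^{-1}k)[0,1]+i\,b^{-1}\mathbb Z,\qquad \sigma(\tilde q)=i(\bar b-\bar b^{-1}k)[0,1]+i\,\bar b^{-1}\mathbb Z,$$ $$\sigma(p)=i\,b\,[0,1],\qquad \sigma(\tilde p)=-i\,\bar b\,[0,1].$$ -/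

import Mathlib

open MeasureTheory Set Complex
open scoped ContDiff InnerProductSpace

noncomputable section

/-! ### Unbounded operators on a complex Hilbert space -/

section Unbounded

variable {E : Type*} [NormedAddCommGroup E] [InnerProductSpace ℂ E] [CompleteSpace E]

/-- A normal unbounded operator: densely defined, closed, and `T† T = T T†` as partially defined
operators (equality of the graphs of the two compositions, hence also of their domains). -/
def IsNormalOperator (T : E →ₗ.[ℂ] E) : Prop :=
  Dense (T.domain : Set E) ∧ T.IsClosed ∧
    ∀ x y : E, (∃ z, (x, z) ∈ T.graph ∧ (z, y) ∈ T.adjoint.graph) ↔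
      (∃ z, (x, z) ∈ T.adjoint.graph ∧ (z, y) ∈ T.graph)

/-- An operator given on a dense subspace which is closable and whose closure is normal. -/
def IsEssentiallyNormal (T : E →ₗ.[ℂ] E) : Prop :=
  Dense (T.domain : Set E) ∧ T.IsClosable ∧ IsNormalOperator T.closure

/-- `μ` is in the resolvent set if `T - μ` is a bijection from the domain of `T` onto the whole
space with a bounded inverse `R`. -/
def InResolventSet (T : E →ₗ.[ℂ] E) (μ : ℂ) : Prop :=
  ∃ R : E →L[ℂ] E,
    (∀ y : E, ∃ h : R y ∈ T.domain, T ⟨R y, h⟩ - μ • R y = y) ∧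
    (∀ x : T.domain, R (T x - μ • (x : E)) = x)

/-- The spectrum of an unbounded operator. -/
def unboundedSpectrum (T : E →ₗ.[ℂ] E) : Set ℂ := {μ | ¬ InResolventSet T μ}

end Unbounded

namespace TorusQuantisation

/-! ### Sobolev functions and traces on the unit square -/

/-- Lebesgue measure on `[0,1]²`; the coordinates are `(u', v')`. -/
abbrev squareMeasure : Measure (ℝ × ℝ) :=
  volume.restrict (Icc (0 : ℝ) 1 ×ˢ Icc (0 : ℝ) 1)

/-- Lebesgue measure on `[0,1]`. -/
abbrev intervalMeasure : Measure ℝ := volume.restrict (Icc (0 : ℝ) 1)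

/-- The Hilbert space `L²([0,1]²)`. -/
abbrev L2Square := Lp ℂ 2 squareMeasure

/-- The space `L²([0,1])`, in which boundary values live. -/
abbrev L2Interval := Lp ℂ 2 intervalMeasure

lemma integrable_square {φ : ℝ × ℝ → ℝ} (hφ : Continuous φ) (f : L2Square) :
    Integrable (fun x => φ x • f x) squareMeasure := by
  have hK : IsCompact (Icc (0 : ℝ) 1 ×ˢ Icc (0 : ℝ) 1) := isCompact_Icc.prod isCompact_Icc
  have : IsFiniteMeasure squareMeasure :=
    ⟨by rw [Measure.restrict_apply_univ]; exact hK.measure_lt_top⟩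
  have hf : IntegrableOn f (Icc (0 : ℝ) 1 ×ˢ Icc (0 : ℝ) 1) volume :=
    (Lp.memLp f).integrable (by norm_num)
  exact hf.continuousOn_smul hφ.continuousOn hK

lemma integrable_interval {φ : ℝ → ℝ} (hφ : Continuous φ) (f : L2Interval) :
    Integrable (fun x => φ x • f x) intervalMeasure := by
  have : IsFiniteMeasure intervalMeasure :=
    ⟨by rw [Measure.restrict_apply_univ]; exact isCompact_Icc.measure_lt_top⟩
  have hf : IntegrableOn f (Icc (0 : ℝ) 1) volume :=
    (Lp.memLp f).integrable (by norm_num)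
  exact hf.continuousOn_smul hφ.continuousOn isCompact_Icc

lemma integral_square_add {φ : ℝ × ℝ → ℝ} (hφ : Continuous φ) (f g : L2Square) :
    ∫ x, φ x • (f + g) x ∂squareMeasure
      = ∫ x, φ x • f x ∂squareMeasure + ∫ x, φ x • g x ∂squareMeasure := by
  rw [← integral_add (integrable_square hφ f) (integrable_square hφ g)]
  refine integral_congr_ae ?_
  filter_upwards [Lp.coeFn_add f g] with x hx
  simp only [hx, Pi.add_apply, smul_add]

lemma integral_square_smul (φ : ℝ × ℝ → ℝ) (c : ℂ) (f : L2Square) :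
    ∫ x, φ x • (c • f) x ∂squareMeasure = c * ∫ x, φ x • f x ∂squareMeasure := by
  rw [← integral_const_mul]
  refine integral_congr_ae ?_
  filter_upwards [Lp.coeFn_smul c f] with x hx
  simp [hx]
  ring

lemma integral_interval_add {φ : ℝ → ℝ} (hφ : Continuous φ) (f g : L2Interval) :
    ∫ x, φ x • (f + g) x ∂intervalMeasure
      = ∫ x, φ x • f x ∂intervalMeasure + ∫ x, φ x • g x ∂intervalMeasure := by
  rw [← integral_add (integrable_interval hφ f) (integrable_interval hφ g)]
  refine integral_congr_ae ?_
  filter_upwards [Lp.coeFn_add f g] with x hx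
  simp only [hx, Pi.add_apply, smul_add]

lemma integral_interval_smul (φ : ℝ → ℝ) (c : ℂ) (f : L2Interval) :
    ∫ x, φ x • (c • f) x ∂intervalMeasure = c * ∫ x, φ x • f x ∂intervalMeasure := by
  rw [← integral_const_mul]
  refine integral_congr_ae ?_
  filter_upwards [Lp.coeFn_smul c f] with x hx
  simp [hx]
  ring

lemma continuous_partial {φ : ℝ × ℝ → ℝ} (hφ : ContDiff ℝ ∞ φ) (e : ℝ × ℝ) :
    Continuous (fun x => fderiv ℝ φ x e) :=
  (hφ.continuous_fderiv (by simp)).clm_apply continuous_const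

/-- `g` is the weak derivative of `f` in the direction `e` in the open unit square. -/
def IsWeakPartial (e : ℝ × ℝ) (f g : L2Square) : Prop :=
  ∀ φ : ℝ × ℝ → ℝ, ContDiff ℝ ∞ φ → HasCompactSupport φ →
    tsupport φ ⊆ Ioo (0 : ℝ) 1 ×ˢ Ioo (0 : ℝ) 1 →
    ∫ x, fderiv ℝ φ x e • f x ∂squareMeasure = - ∫ x, φ x • g x ∂squareMeasure

/-- The graph of the weak derivative in the direction `e`. -/
def weakPartialGraph (e : ℝ × ℝ) : Submodule ℂ (L2Square × L2Square) where
  carrier := {fg | IsWeakPartial e fg.1 fg.2}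
  zero_mem' := fun φ hφ _ _ => by
    have h1 := integral_square_smul (fun x => fderiv ℝ φ x e) 0 0
    have h2 := integral_square_smul φ 0 0
    rw [zero_smul, zero_mul] at h1 h2
    exact h1.trans (by rw [← neg_zero]; exact congrArg Neg.neg h2.symm)
  add_mem' := fun {x y} hx hy φ hφ hc hs => by
    have h1 := hx φ hφ hc hs
    have h2 := hy φ hφ hc hs
    simp only [Prod.fst_add, Prod.snd_add]
    rw [integral_square_add (continuous_partial hφ e), integral_square_add hφ.continuous, h1, h2]
    ring
  smul_mem' := fun c x hx φ hφ hc hs => by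
    have h1 := hx φ hφ hc hs
    simp only [Prod.smul_fst, Prod.smul_snd]
    rw [integral_square_smul, integral_square_smul, h1]
    ring

/-- Weak derivatives are unique, so that `weakPartialGraph e` is the graph of an operator. -/
lemma weakPartialGraph_single_valued (e : ℝ × ℝ) :
    ∀ x ∈ weakPartialGraph e, x.1 = 0 → x.2 = 0 := by
  rintro ⟨f, g⟩ h (rfl : f = 0)
  have hU : IsOpen (Ioo (0 : ℝ) 1 ×ˢ Ioo (0 : ℝ) 1) := isOpen_Ioo.prod isOpen_Ioo
  have hsq : (Ioo (0 : ℝ) 1 ×ˢ Ioo (0 : ℝ) 1 : Set (ℝ × ℝ)) =ᵐ[volume]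
      (Icc (0 : ℝ) 1 ×ˢ Icc (0 : ℝ) 1 : Set (ℝ × ℝ)) :=
    Measure.set_prod_ae_eq Ioo_ae_eq_Icc Ioo_ae_eq_Icc
  have hint : IntegrableOn g (Icc (0 : ℝ) 1 ×ˢ Icc (0 : ℝ) 1) volume := by
    have h0 := integrable_square (φ := fun _ => 1) continuous_const g
    simp only [one_smul] at h0
    exact h0
  have key := hU.ae_eq_zero_of_integral_contDiff_smul_eq_zero (μ := volume) (f := g)
    ((hint.mono_set (prod_mono Ioo_subset_Icc_self Ioo_subset_Icc_self)).locallyIntegrableOn)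
    (fun φ hφ hc hs => by
      have h1 := h φ hφ hc hs
      have h2 := integral_square_smul (fun x => fderiv ℝ φ x e) 0 0
      rw [zero_smul, zero_mul] at h2
      have h3 : ∫ x, φ x • g x ∂squareMeasure = 0 := by
        rw [← neg_eq_zero, ← h1]; exact h2
      rw [← h3]
      symm
      refine setIntegral_eq_integral_of_forall_compl_eq_zero fun x hx => ?_
      have : φ x = 0 := image_eq_zero_of_notMem_tsupport fun hx' =>
        hx (prod_mono Ioo_subset_Icc_self Ioo_subset_Icc_self (hs hx'))
      simp [this])
  change g = 0
  rw [Lp.eq_zero_iff_ae_eq_zero]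
  have h4 : ∀ᵐ x ∂(volume.restrict (Ioo (0 : ℝ) 1 ×ˢ Ioo (0 : ℝ) 1)), g x = 0 :=
    (ae_restrict_iff' hU.measurableSet).2 key
  rw [Measure.restrict_congr_set hsq] at h4
  exact h4

/-- The weak derivative in the direction `e`, as an operator in `L²([0,1]²)` defined on all
functions whose weak derivative in this direction is square integrable. -/
def weakPartial (e : ℝ × ℝ) : L2Square →ₗ.[ℂ] L2Square := (weakPartialGraph e).toLinearPMap

/-- The Sobolev space `H¹([0,1]²)`. -/
def sobolevH1 : Submodule ℂ L2Square := (weakPartial (1, 0)).domain ⊓ (weakPartial (0, 1)).domain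

/-- `l` and `r` are the traces of `f` on the sides `t ↦ a t` and `t ↦ c t` of the square, which are
opposite in the direction `e`: Green's formula holds for every smooth test function. -/
def HasTracesAlong (e : ℝ × ℝ) (a c : ℝ → ℝ × ℝ) (f : L2Square) (l r : L2Interval) : Prop :=
  ∃ g : L2Square, IsWeakPartial e f g ∧ ∀ φ : ℝ × ℝ → ℝ, ContDiff ℝ ∞ φ →
    ∫ x, fderiv ℝ φ x e • f x ∂squareMeasure + ∫ x, φ x • g x ∂squareMeasure
      = ∫ t, φ (c t) • r t ∂intervalMeasure - ∫ t, φ (a t) • l t ∂intervalMeasure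

/-- The boundary values `s(0, v') = l(v')` and `s(1, v') = r(v')`. -/
def HasTracesU (s : L2Square) (l r : L2Interval) : Prop :=
  HasTracesAlong (1, 0) (fun t => (0, t)) (fun t => (1, t)) s l r

/-- The boundary values `s(u', 0) = l(u')` and `s(u', 1) = r(u')`. -/
def HasTracesV (s : L2Square) (l r : L2Interval) : Prop :=
  HasTracesAlong (0, 1) (fun t => (t, 0)) (fun t => (t, 1)) s l r

section

variable {e : ℝ × ℝ} {a c : ℝ → ℝ × ℝ}

lemma HasTracesAlong.add (ha : Continuous a) (hc : Continuous c) {f f' : L2Square}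
    {l l' r r' : L2Interval} (h : HasTracesAlong e a c f l r) (h' : HasTracesAlong e a c f' l' r') :
    HasTracesAlong e a c (f + f') (l + l') (r + r') := by
  obtain ⟨g, hg, hG⟩ := h
  obtain ⟨g', hg', hG'⟩ := h'
  refine ⟨g + g', (weakPartialGraph e).add_mem (x := (f, g)) (y := (f', g')) hg hg',
    fun φ hφ => ?_⟩
  have h1 := hG φ hφ
  have h2 := hG' φ hφ
  rw [integral_square_add (continuous_partial hφ e), integral_square_add hφ.continuous,
    integral_interval_add (φ := fun t => φ (c t)) (hφ.continuous.comp hc),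
    integral_interval_add (φ := fun t => φ (a t)) (hφ.continuous.comp ha)]
  linear_combination h1 + h2

lemma HasTracesAlong.smul (z : ℂ) {f : L2Square} {l r : L2Interval}
    (h : HasTracesAlong e a c f l r) : HasTracesAlong e a c (z • f) (z • l) (z • r) := by
  obtain ⟨g, hg, hG⟩ := h
  refine ⟨z • g, (weakPartialGraph e).smul_mem z (x := (f, g)) hg, fun φ hφ => ?_⟩
  have h1 := hG φ hφ
  rw [integral_square_smul, integral_square_smul,
    integral_interval_smul (fun t => φ (c t)), integral_interval_smul (fun t => φ (a t))]
  linear_combination z * h1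

end

lemma HasTracesU.add {f f' : L2Square} {l l' r r' : L2Interval} (h : HasTracesU f l r)
    (h' : HasTracesU f' l' r') : HasTracesU (f + f') (l + l') (r + r') :=
  HasTracesAlong.add (by fun_prop) (by fun_prop) h h'

lemma HasTracesV.add {f f' : L2Square} {l l' r r' : L2Interval} (h : HasTracesV f l r)
    (h' : HasTracesV f' l' r') : HasTracesV (f + f') (l + l') (r + r') :=
  HasTracesAlong.add (by fun_prop) (by fun_prop) h h'

lemma HasTracesU.smul (z : ℂ) {f : L2Square} {l r : L2Interval} (h : HasTracesU f l r) :
    HasTracesU (z • f) (z • l) (z • r) :=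
  HasTracesAlong.smul z h

lemma HasTracesV.smul (z : ℂ) {f : L2Square} {l r : L2Interval} (h : HasTracesV f l r) :
    HasTracesV (z • f) (z • l) (z • r) :=
  HasTracesAlong.smul z h

lemma HasTracesAlong.zero (e : ℝ × ℝ) (a c : ℝ → ℝ × ℝ) : HasTracesAlong e a c 0 0 0 := by
  refine ⟨0, (weakPartialGraph e).zero_mem, fun φ hφ => ?_⟩
  have h1 := integral_square_smul (fun x => fderiv ℝ φ x e) 0 0
  have h2 := integral_square_smul φ 0 0
  have h3 := integral_interval_smul (fun t => φ (c t)) 0 0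
  have h4 := integral_interval_smul (fun t => φ (a t)) 0 0
  rw [zero_smul, zero_mul] at h1 h2 h3 h4
  rw [h1, h2, h3, h4]
  simp

/-- The space `H'` of all `s ∈ H¹([0,1]²)` with `s(1, v') = e^{πikv'} s(0, v')` and
`s(u', 1) = e^{-πiku'} s(u', 0)`. -/
def quasiPeriodicH1 (k : ℤ) : Submodule ℂ L2Square where
  carrier := {s | s ∈ sobolevH1 ∧
    (∃ l r, HasTracesU s l r ∧
      ∀ᵐ v ∂intervalMeasure, r v = exp (Real.pi * I * k * v) * l v) ∧
    (∃ l r, HasTracesV s l r ∧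
      ∀ᵐ u ∂intervalMeasure, r u = exp (-(Real.pi * I * k * u)) * l u)}
  zero_mem' := by
    refine ⟨sobolevH1.zero_mem, ⟨0, 0, HasTracesAlong.zero _ _ _, ?_⟩,
      ⟨0, 0, HasTracesAlong.zero _ _ _, ?_⟩⟩ <;>
    · filter_upwards [Lp.coeFn_zero ℂ 2 intervalMeasure] with x hx
      simp only [hx, Pi.zero_apply, mul_zero]
  add_mem' := by
    rintro x y ⟨hx, ⟨l, r, h1, h2⟩, ⟨l', r', h3, h4⟩⟩ ⟨hy, ⟨m, n, g1, g2⟩, ⟨m', n', g3, g4⟩⟩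
    refine ⟨sobolevH1.add_mem hx hy, ⟨l + m, r + n, h1.add g1, ?_⟩,
      ⟨l' + m', r' + n', h3.add g3, ?_⟩⟩
    · filter_upwards [h2, g2, Lp.coeFn_add l m, Lp.coeFn_add r n] with x a1 a2 a3 a4
      simp only [a3, a4, Pi.add_apply, a1, a2]
      ring
    · filter_upwards [h4, g4, Lp.coeFn_add l' m', Lp.coeFn_add r' n'] with x a1 a2 a3 a4
      simp only [a3, a4, Pi.add_apply, a1, a2]
      ring
  smul_mem' := by
    rintro c x ⟨hx, ⟨l, r, h1, h2⟩, ⟨l', r', h3, h4⟩⟩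
    refine ⟨sobolevH1.smul_mem c hx, ⟨c • l, c • r, h1.smul c, ?_⟩,
      ⟨c • l', c • r', h3.smul c, ?_⟩⟩
    · filter_upwards [h2, Lp.coeFn_smul c l, Lp.coeFn_smul c r] with x a1 a3 a4
      simp only [a3, a4, Pi.smul_apply, a1, smul_eq_mul]
      ring
    · filter_upwards [h4, Lp.coeFn_smul c l', Lp.coeFn_smul c r'] with x a1 a3 a4
      simp only [a3, a4, Pi.smul_apply, a1, smul_eq_mul]
      ring

/-- The subspace `{s ∈ H' | s(0, v') = 0}`. -/
def vanishingLeft (k : ℤ) : Submodule ℂ L2Square where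
  carrier := {s | s ∈ quasiPeriodicH1 k ∧ ∃ r, HasTracesU s 0 r}
  zero_mem' := ⟨Submodule.zero_mem _, 0, HasTracesAlong.zero _ _ _⟩
  add_mem' := by
    rintro x y ⟨hx, r, h⟩ ⟨hy, r', h'⟩
    exact ⟨Submodule.add_mem _ hx hy, r + r', by simpa using h.add h'⟩
  smul_mem' := by
    rintro c x ⟨hx, r, h⟩
    exact ⟨Submodule.smul_mem _ c hx, c • r, by simpa using h.smul c⟩

/-- The subspace `{s ∈ H' | s(u', 0) = 0}`. -/
def vanishingBottom (k : ℤ) : Submodule ℂ L2Square where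
  carrier := {s | s ∈ quasiPeriodicH1 k ∧ ∃ r, HasTracesV s 0 r}
  zero_mem' := ⟨Submodule.zero_mem _, 0, HasTracesAlong.zero _ _ _⟩
  add_mem' := by
    rintro x y ⟨hx, r, h⟩ ⟨hy, r', h'⟩
    exact ⟨Submodule.add_mem _ hx hy, r + r', by simpa using h.add h'⟩
  smul_mem' := by
    rintro c x ⟨hx, r, h⟩
    exact ⟨Submodule.smul_mem _ c hx, c • r, by simpa using h.smul c⟩

/-! ### The prequantum operators -/

/-- Multiplication by a continuous real function on the square. -/
def mulOp (m : C(ℝ × ℝ, ℝ)) : L2Square →ₗ[ℂ] L2Square :=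
  have hm : ∀ f : L2Square, MemLp (fun x => (m x : ℂ) * f x) 2 squareMeasure := fun f => by
    obtain ⟨C, hC⟩ := (isCompact_Icc.prod isCompact_Icc :
      IsCompact (Icc (0 : ℝ) 1 ×ˢ Icc (0 : ℝ) 1)).exists_bound_of_continuousOn
      m.continuous.continuousOn
    have hmeas : AEStronglyMeasurable (fun x => (m x : ℂ) * f x) squareMeasure :=
      (Complex.continuous_ofReal.comp m.continuous).aestronglyMeasurable.mul
        (Lp.aestronglyMeasurable f)
    refine (Lp.memLp f).of_le_mul (c := C) hmeas ?_
    refine (ae_restrict_iff' (measurableSet_Icc.prod measurableSet_Icc)).2 (.of_forall fun x hx => ?_)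
    rw [norm_mul, Complex.norm_real]
    exact mul_le_mul_of_nonneg_right (hC x hx) (norm_nonneg _)
  { toFun := fun f => (hm f).toLp
    map_add' := fun f g => by
      rw [← MemLp.toLp_add]
      refine MemLp.toLp_congr _ _ ?_
      filter_upwards [Lp.coeFn_add f g] with x hx
      simp only [hx, Pi.add_apply, mul_add]
    map_smul' := fun c f => by
      rw [RingHom.id_apply, ← MemLp.toLp_const_smul]
      refine MemLp.toLp_congr _ _ ?_
      filter_upwards [Lp.coeFn_smul c f] with x hx
      simp [hx]
      ring }

/-- Multiplication by the coordinate `u'`. -/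
def mulU : L2Square →ₗ[ℂ] L2Square := mulOp ⟨fun x => x.1, continuous_fst⟩

/-- Multiplication by the coordinate `v'`. -/
def mulV : L2Square →ₗ[ℂ] L2Square := mulOp ⟨fun x => x.2, continuous_snd⟩

/-- The covariant derivative `∂/∂u' + iπk v'` of the connection `d + iπk (v' du' - u' dv')`. -/
def nablaU (k : ℤ) : L2Square →ₗ.[ℂ] L2Square :=
  ((I * Real.pi * k : ℂ) • mulV) +ᵥ weakPartial (1, 0)

/-- The covariant derivative `∂/∂v' - iπk u'` of the connection `d + iπk (v' du' - u' dv')`. -/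
def nablaV (k : ℤ) : L2Square →ₗ.[ℂ] L2Square :=
  ((-(I * Real.pi * k) : ℂ) • mulU) +ᵥ weakPartial (0, 1)

/-- The deformation parameter `t = 4πb²`. -/
def tParam (b : ℂ) : ℂ := 4 * Real.pi * b ^ 2

/-- `P_{u'} = -(i/t) ∇_{v'} + u'`. -/
def prequantumU' (b : ℂ) (k : ℤ) : L2Square →ₗ.[ℂ] L2Square :=
  mulU +ᵥ ((-(I / tParam b) : ℂ) • nablaV k)

/-- `P_{u''} = -(1/t) ∇_{v'}`. -/
def prequantumU'' (b : ℂ) (k : ℤ) : L2Square →ₗ.[ℂ] L2Square :=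
  (-(1 / tParam b) : ℂ) • nablaV k

/-- `P_{v'} = (i/t̄) ∇_{u'} + v'`. -/
def prequantumV' (b : ℂ) (k : ℤ) : L2Square →ₗ.[ℂ] L2Square :=
  mulV +ᵥ ((I / starRingEnd ℂ (tParam b) : ℂ) • nablaU k)

/-- `P_{v''} = -(1/t̄) ∇_{u'}`. -/
def prequantumV'' (b : ℂ) (k : ℤ) : L2Square →ₗ.[ℂ] L2Square :=
  (-(1 / starRingEnd ℂ (tParam b)) : ℂ) • nablaU k

/-- `q = ib P_u` with `P_u = P_{u'} + i P_{u''}`, on the domain `{s ∈ H' | s(0, v') = 0}`. -/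
def opQ (b : ℂ) (k : ℤ) : L2Square →ₗ.[ℂ] L2Square :=
  ((I * b : ℂ) • (prequantumU' b k + (I : ℂ) • prequantumU'' b k)).domRestrict (vanishingLeft k)

/-- `p = ib P_v` with `P_v = P_{v'} + i P_{v''}`, on the domain `{s ∈ H' | s(0, v') = 0}`. -/
def opP (b : ℂ) (k : ℤ) : L2Square →ₗ.[ℂ] L2Square :=
  ((I * b : ℂ) • (prequantumV' b k + (I : ℂ) • prequantumV'' b k)).domRestrict (vanishingLeft k)

/-- `q̃ = ib̄ P_{v̄}` with `P_{v̄} = P_{v'} - i P_{v''}`, on the domain `{s ∈ H' | s(u', 0) = 0}`. -/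
def opQtilde (b : ℂ) (k : ℤ) : L2Square →ₗ.[ℂ] L2Square :=
  ((I * starRingEnd ℂ b : ℂ) •
    (prequantumV' b k + (-I : ℂ) • prequantumV'' b k)).domRestrict (vanishingBottom k)

/-- `p̃ = -ib̄ P_{ū}` with `P_{ū} = P_{u'} - i P_{u''}`, on the domain `{s ∈ H' | s(u', 0) = 0}`. -/
def opPtilde (b : ℂ) (k : ℤ) : L2Square →ₗ.[ℂ] L2Square :=
  ((-(I * starRingEnd ℂ b) : ℂ) •
    (prequantumU' b k + (-I : ℂ) • prequantumU'' b k)).domRestrict (vanishingBottom k)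

end TorusQuantisation

end

/-! On functions of `v'` with `s(u',1) = e^{-πiku'} s(u',0)`, the exponentials `e^{(2πin -
iπku')v'}` form, for each fixed `u'`, an orthonormal basis of eigenfunctions of `∂/∂v'`, with
eigenvalue `2πin - iπku'`. Expanding fibrewise in them identifies `L²([0,1]²)` with a Hilbert sum
over `n ∈ ℤ` of copies of `L²([0,1])` (`modeTransform`). Since `q = (1/2πb) ∂_{v'} + (ib - ik/2b)
u'`, it acts on the `n`-th summand as multiplication by `i(b - k/b) u' + in/b`. Green's formula
proves this for every element of the domain (`modeTransform_weakPartial`): quasi-periodicity makes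
the boundary terms cancel.

So `q` is contained in a maximal diagonal operator `diagOp` with bounded normal entries. Such an
operator is closed and normal, and it is the closure of `q` because the functions `φ(u')` times a
mode, with `φ` a test function on `(0,1)`, lie in the domain and approximate every graph element
supported in one summand (`isEssentiallyNormal_firstOrder`). The condition `s(0,v') = 0` is lost in
the closure: `q` does not differentiate in `u'`. The spectrum is the union over `n` of the ranges of
the multipliers. This union is a compact segment plus a closed discrete set, hence closed, and off
it the fibre inverses are uniformly bounded (`unboundedSpectrum_diagOp_affineMul`).

Interchanging the coordinates turns `q̃` into an operator of the same type with `k` replaced by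
`-k`. In `p` and `p̃` the derivatives cancel, leaving multiplication by a coordinate on a dense
domain, whose closure is bounded; it is treated as a diagonal operator with all entries equal
(`isEssentiallyNormal_multiplication`). -/

/-! ### Diagonal operators on a Hilbert sum -/

section Diagonal

variable {E G : Type*} [NormedAddCommGroup E] [InnerProductSpace ℂ E]
  [NormedAddCommGroup G] [InnerProductSpace ℂ G]

/-- The graph of the operator acting as `A n` on the `n`-th summand of a Hilbert sum. -/
def diagGraph (W : E ≃ₗᵢ[ℂ] lp (fun _ : ℤ => G) 2) (A : ℤ → G →L[ℂ] G) :
    Submodule ℂ (E × E) where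
  carrier := {p | ∀ n, W p.2 n = A n (W p.1 n)}
  zero_mem' := fun n => by simp
  add_mem' := fun {x y} hx hy n => by simp [hx n, hy n]
  smul_mem' := fun c x hx n => by simp [hx n]

/-- The operator acting as `A n` on the `n`-th summand of a Hilbert sum, on its maximal domain. -/
noncomputable def diagOp (W : E ≃ₗᵢ[ℂ] lp (fun _ : ℤ => G) 2) (A : ℤ → G →L[ℂ] G) :
    E →ₗ.[ℂ] E := (diagGraph W A).toLinearPMap

variable (W : E ≃ₗᵢ[ℂ] lp (fun _ : ℤ => G) 2) (A : ℤ → G →L[ℂ] G)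

lemma mem_diagGraph {x y : E} : (x, y) ∈ diagGraph W A ↔ ∀ n, W y n = A n (W x n) := Iff.rfl

lemma ext_coord {x y : E} (h : ∀ n, W x n = W y n) : x = y :=
  W.injective (lp.ext (funext h))

lemma graph_diagOp : (diagOp W A).graph = diagGraph W A := by
  refine Submodule.toLinearPMap_graph_eq _ ?_
  rintro ⟨x, y⟩ h (rfl : x = 0)
  exact ext_coord W fun n => by simpa using h n

lemma continuous_coord (n : ℤ) : Continuous fun x : E => W x n :=
  (lp.evalCLM ℂ (fun _ : ℤ => G) 2 n).continuous.comp W.continuous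

lemma isClosed_diagGraph : IsClosed (diagGraph W A : Set (E × E)) := by
  have : (diagGraph W A : Set (E × E)) = ⋂ n, {p | W p.2 n = A n (W p.1 n)} := by
    ext p; simp [diagGraph]
  rw [this]
  refine isClosed_iInter fun n => isClosed_eq ((continuous_coord W n).comp continuous_snd)
    ((A n).continuous.comp ((continuous_coord W n).comp continuous_fst))

lemma coord_single (n m : ℤ) (a : G) :
    W (W.symm (lp.single 2 n a)) m = if m = n then a else 0 := by
  rw [W.apply_symm_apply, lp.single_apply]
  simp [Pi.single_apply]

lemma single_mem_diagGraph (n : ℤ) (a : G) :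
    (W.symm (lp.single 2 n a), W.symm (lp.single 2 n (A n a))) ∈ diagGraph W A := by
  intro m
  rw [coord_single, coord_single]
  split_ifs with h
  · rw [h]
  · simp

/-- A closed subspace containing all graph elements in the summands contains the graph. -/
lemma diagGraph_le {S : Submodule ℂ (E × E)} (hS : IsClosed (S : Set (E × E)))
    (h : ∀ n a, (W.symm (lp.single 2 n a), W.symm (lp.single 2 n (A n a))) ∈ S) :
    diagGraph W A ≤ S := by
  rintro ⟨x, y⟩ hxy
  have key : ∀ z : E, HasSum (fun n => W.symm (lp.single 2 n (W z n))) z := fun z => by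
    have h1 := (lp.hasSum_single (p := 2) (by norm_num) (W z)).mapL
      (W.symm.toContinuousLinearEquiv : lp (fun _ : ℤ => G) 2 →L[ℂ] E)
    simpa using h1
  have h2 := (key x).prodMk (key y)
  refine hS.mem_of_tendsto h2 (Filter.Eventually.of_forall fun s => ?_)
  refine S.sum_mem fun n _ => ?_
  rw [hxy n]
  exact h n _

/-- Membership is only required in the closure because in the applications a vector of a single
summand is merely a limit of test functions. -/
lemma dense_of_single_mem {S : Submodule ℂ E}
    (h : ∀ n a, W.symm (lp.single 2 n a) ∈ S.topologicalClosure) : Dense (S : Set E) := by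
  rw [Submodule.dense_iff_topologicalClosure_eq_top, eq_top_iff]
  rintro x -
  have h1 := (lp.hasSum_single (p := 2) (by norm_num) (W x)).mapL
      (W.symm.toContinuousLinearEquiv : lp (fun _ : ℤ => G) 2 →L[ℂ] E)
  have h2 : HasSum (fun n => W.symm (lp.single 2 n (W x n))) x := by simpa using h1
  exact S.isClosed_topologicalClosure.mem_of_tendsto h2
    (Filter.Eventually.of_forall fun s => Submodule.sum_mem _ fun n _ => h n _)

lemma dense_domain_diagOp : Dense ((diagOp W A).domain : Set E) := by
  refine dense_of_single_mem W fun n a => Submodule.le_topologicalClosure _ ?_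
  refine LinearPMap.mem_domain_of_mem_graph (y := W.symm (lp.single 2 n (A n a))) ?_
  rw [graph_diagOp]
  exact single_mem_diagGraph W A n a

lemma inner_single_coord (n : ℤ) (a : G) (x : E) :
    ⟪W.symm (lp.single 2 n a), x⟫_ℂ = ⟪a, W x n⟫_ℂ := by
  rw [← W.inner_map_map, W.apply_symm_apply, lp.inner_single_left]

/-- Pairing with graph elements supported in one summand determines each coordinate of the adjoint.
Conversely the inner products are sums over `n`, so the adjoint relation can be checked termwise. -/
lemma graph_adjoint_diagOp [CompleteSpace E] [CompleteSpace G] :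
    (diagOp W A).adjoint.graph = diagGraph W fun n => (A n).adjoint := by
  rw [LinearPMap.adjoint_graph_eq_graph_adjoint (dense_domain_diagOp W A), graph_diagOp]
  ext ⟨x, y⟩
  simp only [Submodule.mem_adjoint_iff, mem_diagGraph, sub_eq_zero]
  constructor
  · intro h n
    refine ext_inner_left ℂ fun a => ?_
    have h1 := h _ _ (single_mem_diagGraph W A n a)
    rw [inner_single_coord, inner_single_coord] at h1
    rw [← h1, ContinuousLinearMap.adjoint_inner_right]
  · intro h z w hzw
    rw [← W.inner_map_map w x, ← W.inner_map_map z y, lp.inner_eq_tsum, lp.inner_eq_tsum]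
    refine tsum_congr fun n => ?_
    rw [h n, hzw n, ContinuousLinearMap.adjoint_inner_right]

/-- An element whose coordinates are dominated by those of a given one. -/
lemma exists_coord_eq (z : E) (f : ℤ → G) (hf : ∀ n, ‖f n‖ ≤ ‖W z n‖) :
    ∃ y, ∀ n, W y n = f n := by
  have hm : Memℓp f 2 := (lp.memℓp (W z)).norm.mono (fun n => by simpa using hf n)
  exact ⟨W.symm ⟨f, hm⟩, fun n => by rw [W.apply_symm_apply]⟩

/-- Normality of `A n` gives `‖(A n)† v‖ = ‖A n v‖`, so the sequence `(A n)† xₙ` is square summable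
as soon as `A n xₙ` is. This supplies the intermediate vector for the other order of composition,
with no bound on `A n` uniform in `n`. -/
lemma isNormalOperator_diagOp [CompleteSpace E] [CompleteSpace G]
    (hA : ∀ n, IsStarNormal (A n)) : IsNormalOperator (diagOp W A) := by
  refine ⟨dense_domain_diagOp W A, ?_, fun x y => ?_⟩
  · rw [LinearPMap.IsClosed, graph_diagOp]
    exact isClosed_diagGraph W A
  · have hn : ∀ n v, ‖(A n).adjoint v‖ = ‖A n v‖ := fun n v =>
      ((ContinuousLinearMap.isStarNormal_iff_norm_eq_adjoint).1 (hA n) v).symm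
    have hc : ∀ n v, (A n).adjoint (A n v) = A n ((A n).adjoint v) := fun n v =>
      congrArg (fun B : G →L[ℂ] G => B v) (hA n).star_comm_self.eq
    rw [graph_adjoint_diagOp, graph_diagOp]
    simp only [mem_diagGraph]
    constructor
    · rintro ⟨z, h1, h2⟩
      obtain ⟨w, hw⟩ := exists_coord_eq W z (fun n => (A n).adjoint (W x n))
        fun n => by rw [hn, h1]
      exact ⟨w, hw, fun n => by rw [h2, h1, hw, hc]⟩
    · rintro ⟨z, h1, h2⟩
      obtain ⟨w, hw⟩ := exists_coord_eq W z (fun n => A n (W x n))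
        fun n => by rw [← hn, h1]
      exact ⟨w, hw, fun n => by rw [h2, h1, hw, hc]⟩

lemma inResolventSet_diagOp {μ : ℂ} {K : ℝ} (hK : 0 ≤ K) (B : ℤ → G →L[ℂ] G)
    (hB : ∀ n, ‖B n‖ ≤ K) (h1 : ∀ n a, B n (A n a - μ • a) = a)
    (h2 : ∀ n a, A n (B n a) - μ • B n a = a) : InResolventSet (diagOp W A) μ := by
  let R : E →L[ℂ] E := (W.symm.toContinuousLinearEquiv : lp (fun _ : ℤ => G) 2 →L[ℂ] E) ∘L
    (lp.mapCLM 2 B hK hB) ∘L (W.toContinuousLinearEquiv : E →L[ℂ] lp (fun _ : ℤ => G) 2)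
  have hR : ∀ y n, W (R y) n = B n (W y n) := fun y n => by
    simp [R]
  refine ⟨R, fun y => ?_, fun x => ?_⟩
  · have hg : (R y, y + μ • R y) ∈ (diagOp W A).graph := by
      rw [graph_diagOp]
      intro n
      have := h2 n (W y n)
      simp only [map_add, map_smul, lp.coeFn_add, lp.coeFn_smul, Pi.add_apply, Pi.smul_apply, hR]
      rw [← eq_sub_iff_add_eq.1 this.symm]
    have hd := LinearPMap.mem_domain_of_mem_graph hg
    refine ⟨hd, ?_⟩
    have := LinearPMap.mem_graph_snd_inj _ ((diagOp W A).mem_graph ⟨R y, hd⟩) hg rfl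
    rw [this, add_sub_cancel_right]
  · have hg := (diagOp W A).mem_graph x
    rw [graph_diagOp] at hg
    refine ext_coord W fun n => ?_
    rw [hR, map_sub, lp.coeFn_sub, Pi.sub_apply, hg n, map_smul, lp.coeFn_smul, Pi.smul_apply, h1]

lemma not_inResolventSet_diagOp {μ : ℂ} (n : ℤ)
    (h : ∀ ε > 0, ∃ a : G, a ≠ 0 ∧ ‖A n a - μ • a‖ ≤ ε * ‖a‖) :
    ¬ InResolventSet (diagOp W A) μ := by
  rintro ⟨R, -, hR⟩
  -- With this tolerance the left inverse `R` would give `‖a‖ ≤ ‖a‖ / 2`; the `+ 1` covers `R = 0`.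
  obtain ⟨a, ha0, ha⟩ := h (1 / (2 * (‖R‖ + 1))) (by positivity)
  have hg : (W.symm (lp.single 2 n a), W.symm (lp.single 2 n (A n a))) ∈ (diagOp W A).graph := by
    rw [graph_diagOp]; exact single_mem_diagGraph W A n a
  have hd := LinearPMap.mem_domain_of_mem_graph hg
  have he := LinearPMap.mem_graph_snd_inj _ ((diagOp W A).mem_graph ⟨_, hd⟩) hg rfl
  have h1 := hR ⟨_, hd⟩
  rw [he] at h1
  have h2 : W.symm (lp.single 2 n (A n a)) - μ • W.symm (lp.single 2 n a)
      = W.symm (lp.single 2 n (A n a - μ • a)) := by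
    rw [lp.single_sub, lp.single_smul, map_sub, map_smul]
  have h3 : ‖a‖ ≤ ‖R‖ * ‖A n a - μ • a‖ := by
    have h4 := R.le_opNorm (W.symm (lp.single 2 n (A n a - μ • a)))
    rw [← h2] at h4
    simp only at h1
    rw [h1, h2, W.symm.norm_map, W.symm.norm_map, lp.norm_single (by norm_num),
      lp.norm_single (by norm_num)] at h4
    exact h4
  have h5 : 0 < ‖a‖ := norm_pos_iff.2 ha0
  have h6 : ‖a‖ ≤ ‖R‖ * (1 / (2 * (‖R‖ + 1)) * ‖a‖) :=
    h3.trans (mul_le_mul_of_nonneg_left ha (norm_nonneg _))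
  have h7 : ‖R‖ * (1 / (2 * (‖R‖ + 1))) ≤ 1 / 2 := by
    rw [mul_one_div, div_le_div_iff₀ (by positivity) (by norm_num)]
    linarith
  nlinarith

/-- An operator contained in a diagonal one, such that its closure contains all graph elements in
the summands, is closable with diagonal closure. -/
lemma closure_eq_diagOp {T : E →ₗ.[ℂ] E} (h1 : ∀ s : T.domain, ∀ n, W (T s) n = A n (W s n))
    (h2 : ∀ n a, (W.symm (lp.single 2 n a), W.symm (lp.single 2 n (A n a)))
      ∈ T.graph.topologicalClosure) : T.IsClosable ∧ T.closure = diagOp W A := by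
  have h3 : T.graph.topologicalClosure = (diagOp W A).graph := by
    rw [graph_diagOp]
    refine le_antisymm (Submodule.topologicalClosure_minimal _ ?_ (isClosed_diagGraph W A))
      (diagGraph_le W A (Submodule.isClosed_topologicalClosure _) h2)
    rintro ⟨x, y⟩ hxy
    obtain ⟨s, rfl, rfl⟩ := T.mem_graph_iff.1 hxy
    exact h1 s
  have hc : T.IsClosable := ⟨_, h3⟩
  refine ⟨hc, LinearPMap.eq_of_eq_graph ?_⟩
  rw [← hc.graph_closure_eq_closure_graph, h3]

lemma isEssentiallyNormal_of_diagonal [CompleteSpace E] [CompleteSpace G] {T : E →ₗ.[ℂ] E}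
    (hA : ∀ n, IsStarNormal (A n))
    (h1 : ∀ s : T.domain, ∀ n, W (T s) n = A n (W s n))
    (h2 : ∀ n a, (W.symm (lp.single 2 n a), W.symm (lp.single 2 n (A n a)))
      ∈ T.graph.topologicalClosure) : IsEssentiallyNormal T := by
  obtain ⟨hc, he⟩ := closure_eq_diagOp W A h1 h2
  refine ⟨dense_of_single_mem W fun n a => ?_, hc, he ▸ isNormalOperator_diagOp W A hA⟩
  -- The first projection carries the closure of the graph into the closure of the domain, so
  -- density needs no separate hypothesis.
  refine closure_mono ?_ (image_closure_subset_closure_image continuous_fst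
    (mem_image_of_mem Prod.fst (h2 n a)))
  rintro _ ⟨p, hp, rfl⟩
  exact LinearPMap.mem_domain_of_mem_graph hp

end Diagonal

/-! ### Multiplication operators on `L²` -/

section BoundedMul

variable {X : Type*} [MeasurableSpace X] {ν : Measure X}

lemma memLp_bounded_mul {m : X → ℂ} (hm : Measurable m) {C : ℝ} (hC : ∀ᵐ x ∂ν, ‖m x‖ ≤ C)
    (f : Lp ℂ 2 ν) : MemLp (fun x => m x * f x) 2 ν := by
  refine (Lp.memLp f).of_le_mul (c := C)
    (hm.aestronglyMeasurable.mul (Lp.aestronglyMeasurable f)) ?_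
  filter_upwards [hC] with x hx
  rw [norm_mul]
  exact mul_le_mul_of_nonneg_right hx (norm_nonneg _)

/-- Multiplication by a bounded measurable function, as an operator on `L²`. -/
noncomputable def boundedMul (m : X → ℂ) (hm : Measurable m) (C : ℝ)
    (hC : ∀ᵐ x ∂ν, ‖m x‖ ≤ C) : Lp ℂ 2 ν →L[ℂ] Lp ℂ 2 ν :=
  LinearMap.mkContinuous
    { toFun := fun f => (memLp_bounded_mul hm hC f).toLp
      map_add' := fun f g => by
        rw [← MemLp.toLp_add]
        refine MemLp.toLp_congr _ _ ?_
        filter_upwards [Lp.coeFn_add f g] with x hx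
        simp only [hx, Pi.add_apply, mul_add]
      map_smul' := fun c f => by
        rw [RingHom.id_apply, ← MemLp.toLp_const_smul]
        refine MemLp.toLp_congr _ _ ?_
        filter_upwards [Lp.coeFn_smul c f] with x hx
        simp only [hx, Pi.smul_apply, smul_eq_mul]
        ring }
    C fun f => by
      refine Lp.norm_le_mul_norm_of_ae_le_mul ?_
      filter_upwards [hC, MemLp.coeFn_toLp (memLp_bounded_mul hm hC f)] with x hx h
      simp only [LinearMap.coe_mk, AddHom.coe_mk]
      rw [h, norm_mul]
      exact mul_le_mul_of_nonneg_right hx (norm_nonneg _)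

lemma coeFn_boundedMul {m : X → ℂ} (hm : Measurable m) {C : ℝ} (hC : ∀ᵐ x ∂ν, ‖m x‖ ≤ C)
    (f : Lp ℂ 2 ν) : boundedMul m hm C hC f =ᵐ[ν] fun x => m x * f x :=
  MemLp.coeFn_toLp (memLp_bounded_mul hm hC f)

lemma norm_boundedMul_le {m : X → ℂ} (hm : Measurable m) {C : ℝ} (h0 : 0 ≤ C)
    (hC : ∀ᵐ x ∂ν, ‖m x‖ ≤ C) : ‖boundedMul m hm C hC‖ ≤ C :=
  LinearMap.mkContinuous_norm_le _ h0 _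

lemma norm_boundedMul_of_norm_eq_one {m : X → ℂ} (hm : Measurable m) {C : ℝ}
    (hC : ∀ᵐ x ∂ν, ‖m x‖ ≤ C) (h1 : ∀ x, ‖m x‖ = 1) (f : Lp ℂ 2 ν) :
    ‖boundedMul m hm C hC f‖ = ‖f‖ := by
  rw [Lp.norm_def, Lp.norm_def]
  congr 1
  refine eLpNorm_congr_norm_ae ?_
  filter_upwards [coeFn_boundedMul hm hC f] with x hx
  rw [hx, norm_mul, h1, one_mul]

end BoundedMul

/-! ### Affine multipliers on `L²([0,1])`: normality, inverses, approximate eigenvectors -/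

namespace TorusQuantisation

lemma ae_mem_interval : ∀ᵐ x ∂intervalMeasure, x ∈ Icc (0 : ℝ) 1 :=
  ae_restrict_mem measurableSet_Icc

instance : IsProbabilityMeasure intervalMeasure := ⟨by simp⟩

/-- Multiplication by the coordinate on `L²([0,1])`. -/
noncomputable def coordMul : L2Interval →L[ℂ] L2Interval :=
  boundedMul (fun x : ℝ => (x : ℂ)) measurable_ofReal 1 (by
    filter_upwards [ae_mem_interval] with x hx
    rw [Complex.norm_real, Real.norm_of_nonneg hx.1]
    exact hx.2)

lemma coeFn_coordMul (f : L2Interval) : coordMul f =ᵐ[intervalMeasure] fun x => (x : ℂ) * f x :=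
  coeFn_boundedMul _ _ f

lemma isSelfAdjoint_coordMul : IsSelfAdjoint coordMul := by
  rw [ContinuousLinearMap.isSelfAdjoint_iff_isSymmetric]
  intro f g
  simp only [ContinuousLinearMap.coe_coe]
  rw [L2.inner_def, L2.inner_def]
  refine integral_congr_ae ?_
  filter_upwards [coeFn_coordMul f, coeFn_coordMul g] with x h1 h2
  rw [h1, h2]
  simp
  ring

/-- Multiplication by `γ x + δ` on `L²([0,1])`. -/
noncomputable def affineMul (γ δ : ℂ) : L2Interval →L[ℂ] L2Interval :=
  γ • coordMul + δ • ContinuousLinearMap.id ℂ L2Interval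

lemma affineMul_apply (γ δ : ℂ) (f : L2Interval) :
    affineMul γ δ f = γ • coordMul f + δ • f := rfl

lemma coeFn_affineMul (γ δ : ℂ) (f : L2Interval) :
    affineMul γ δ f =ᵐ[intervalMeasure] fun x => (γ * x + δ) * f x := by
  rw [affineMul_apply]
  filter_upwards [Lp.coeFn_add (γ • coordMul f) (δ • f), Lp.coeFn_smul γ (coordMul f),
    Lp.coeFn_smul δ f, coeFn_coordMul f] with x h1 h2 h3 h4
  rw [h1, Pi.add_apply, h2, h3, Pi.smul_apply, Pi.smul_apply, h4, smul_eq_mul, smul_eq_mul]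
  ring

/-- A polynomial in the self-adjoint `coordMul` commutes with its adjoint, which is again a
polynomial in `coordMul`. -/
lemma isStarNormal_affineMul (γ δ : ℂ) : IsStarNormal (affineMul γ δ) := by
  refine ⟨?_⟩
  have h := isSelfAdjoint_coordMul.star_eq
  have hid : star (ContinuousLinearMap.id ℂ L2Interval) = ContinuousLinearMap.id ℂ L2Interval :=
    star_one _
  rw [affineMul, star_add, star_smul, star_smul, h, hid]
  change Commute (_ + _ • (1 : L2Interval →L[ℂ] L2Interval))
    (_ + _ • (1 : L2Interval →L[ℂ] L2Interval))
  refine Commute.add_left (Commute.add_right ?_ ?_) (Commute.add_right ?_ ?_)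
  · exact ((Commute.refl _).smul_left _).smul_right _
  · exact ((Commute.one_right _).smul_left _).smul_right _
  · exact ((Commute.one_left _).smul_left _).smul_right _
  · exact ((Commute.one_left _).smul_left _).smul_right _

/-- A bounded inverse of `affineMul γ δ - μ` if `γ x + δ` stays away from `μ`. -/
lemma exists_inverse_affineMul (γ δ μ : ℂ) {ε : ℝ} (hε : 0 < ε)
    (h : ∀ x ∈ Icc (0 : ℝ) 1, ε ≤ ‖γ * x + δ - μ‖) :
    ∃ B : L2Interval →L[ℂ] L2Interval, ‖B‖ ≤ ε⁻¹ ∧ (∀ a, B (affineMul γ δ a - μ • a) = a) ∧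
      ∀ a, affineMul γ δ (B a) - μ • B a = a := by
  have hm : Measurable fun x : ℝ => (γ * x + δ - μ)⁻¹ := by fun_prop
  have hC : ∀ᵐ x : ℝ ∂intervalMeasure, ‖(γ * (x : ℂ) + δ - μ)⁻¹‖ ≤ ε⁻¹ := by
    filter_upwards [ae_mem_interval] with x hx
    rw [norm_inv]
    exact inv_anti₀ hε (h x hx)
  have hne : ∀ x ∈ Icc (0 : ℝ) 1, γ * x + δ - μ ≠ 0 := fun x hx h0 => by
    have := h x hx
    rw [h0, norm_zero] at this
    linarith
  have hsub : ∀ a : L2Interval, ⇑(affineMul γ δ a - μ • a) =ᵐ[intervalMeasure]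
      fun x => (γ * x + δ - μ) * a x := fun a => by
    filter_upwards [Lp.coeFn_sub (affineMul γ δ a) (μ • a), Lp.coeFn_smul μ a,
      coeFn_affineMul γ δ a] with x h1 h2 h3
    rw [h1, Pi.sub_apply, h2, h3, Pi.smul_apply, smul_eq_mul]
    ring
  refine ⟨boundedMul _ hm _ hC, norm_boundedMul_le hm (by positivity) hC, fun a => ?_, fun a => ?_⟩
  · refine Lp.ext ?_
    filter_upwards [coeFn_boundedMul hm hC (affineMul γ δ a - μ • a), hsub a,
      ae_mem_interval] with x h1 h2 hx
    rw [h1, h2, inv_mul_cancel_left₀ (hne x hx)]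
  · refine Lp.ext ?_
    filter_upwards [coeFn_boundedMul hm hC a, hsub (boundedMul _ hm _ hC a),
      ae_mem_interval] with x h1 h2 hx
    rw [h2, h1, mul_inv_cancel_left₀ (hne x hx)]

lemma volume_inter_Icc_pos {x : ℝ} (hx : x ∈ Icc (0 : ℝ) 1) {r : ℝ} (hr : 0 < r) :
    intervalMeasure (Icc (x - r) (x + r)) ≠ 0 := by
  rw [Measure.restrict_apply measurableSet_Icc, Icc_inter_Icc, Real.volume_Icc]
  simp only [ne_eq, ENNReal.ofReal_eq_zero, not_le, sub_pos]
  rw [max_lt_iff, lt_min_iff, lt_min_iff]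
  have := hx.1
  have := hx.2
  refine ⟨⟨?_, ?_⟩, ?_, ?_⟩ <;> linarith

/-- The values of `γ x + δ` are approximate eigenvalues of `affineMul γ δ`. -/
lemma exists_approx_eigenvector (γ δ : ℂ) {x : ℝ} (hx : x ∈ Icc (0 : ℝ) 1) {ε : ℝ} (hε : 0 < ε) :
    ∃ a : L2Interval, a ≠ 0 ∧ ‖affineMul γ δ a - (γ * x + δ) • a‖ ≤ ε * ‖a‖ := by
  -- The eigenvector is the indicator of `[x - r, x + r]`, where the multiplier differs from its
  -- value at `x` by at most `‖γ‖ r ≤ ε`. The `+ 1` allows `γ = 0`.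
  set r : ℝ := ε / (‖γ‖ + 1) with hr
  have hr0 : 0 < r := by positivity
  have hs : MeasurableSet (Icc (x - r) (x + r)) := measurableSet_Icc
  have hfin : intervalMeasure (Icc (x - r) (x + r)) ≠ ⊤ := measure_ne_top _ _
  refine ⟨indicatorConstLp 2 hs hfin 1, ?_, ?_⟩
  · rw [Ne, ← norm_eq_zero, norm_indicatorConstLp (by norm_num) (by norm_num), norm_one, one_mul]
    refine (Real.rpow_pos_of_pos ?_ _).ne'
    exact ENNReal.toReal_pos (volume_inter_Icc_pos hx hr0) hfin
  · refine Lp.norm_le_mul_norm_of_ae_le_mul ?_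
    set a : L2Interval := indicatorConstLp 2 hs hfin 1 with ha
    filter_upwards [Lp.coeFn_sub (affineMul γ δ a) ((γ * x + δ) • a),
      Lp.coeFn_smul (γ * x + δ) a, coeFn_affineMul γ δ a,
      indicatorConstLp_coeFn (p := 2) (hs := hs) (hμs := hfin) (c := (1 : ℂ))] with y h1 h2 h3 h4
    rw [← ha] at h4
    rw [h1, Pi.sub_apply, h2, h3, Pi.smul_apply, smul_eq_mul, h4]
    by_cases hy : y ∈ Icc (x - r) (x + r)
    · rw [indicator_of_mem hy]
      have h5 : (γ * y + δ) * 1 - (γ * x + δ) * 1 = γ * ((y - x : ℝ) : ℂ) := by push_cast; ring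
      rw [h5, norm_mul, Complex.norm_real, norm_one, mul_one, Real.norm_eq_abs]
      have h6 : |y - x| ≤ r := abs_le.2 ⟨by linarith [hy.1], by linarith [hy.2]⟩
      calc ‖γ‖ * |y - x| ≤ (‖γ‖ + 1) * r := by gcongr; linarith
        _ = ε := by rw [hr]; field_simp
    · rw [indicator_of_notMem hy]
      simp

/-! ### Test functions on `(0,1)` and their density -/

/-- Smooth functions with compact support in `(0,1)`. -/
structure IsTestFunction (φ : ℝ → ℝ) : Prop where
  contDiff : ContDiff ℝ ∞ φ
  hasCompactSupport : HasCompactSupport φ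
  tsupport_subset : tsupport φ ⊆ Ioo 0 1

lemma memLp_of_continuous {φ : ℝ → ℂ} (hφ : Continuous φ) : MemLp φ 2 intervalMeasure := by
  obtain ⟨C, hC⟩ := isCompact_Icc.exists_bound_of_continuousOn (s := Icc (0 : ℝ) 1) hφ.continuousOn
  refine MemLp.of_bound hφ.aestronglyMeasurable C ?_
  filter_upwards [ae_mem_interval] with x hx using hC x hx

/-- The element of `L²([0,1])` given by a continuous function. -/
noncomputable def contL2 (φ : ℝ → ℂ) (hφ : Continuous φ) : L2Interval := (memLp_of_continuous hφ).toLp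

lemma coeFn_contL2 {φ : ℝ → ℂ} (hφ : Continuous φ) : contL2 φ hφ =ᵐ[intervalMeasure] φ :=
  MemLp.coeFn_toLp _

lemma IsTestFunction.continuous_ofReal {φ : ℝ → ℝ} (hφ : IsTestFunction φ) :
    Continuous fun x => (φ x : ℂ) := Complex.continuous_ofReal.comp hφ.contDiff.continuous

/-- The subspace of `L²([0,1])` spanned by test functions. -/
noncomputable def testSpan : Submodule ℂ L2Interval :=
  Submodule.span ℂ {a | ∃ (φ : ℝ → ℝ) (h : IsTestFunction φ), a = contL2 _ h.continuous_ofReal}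

/-- An integrable function on `[0,1]` which is orthogonal to all test functions vanishes. -/
lemma ae_eq_zero_of_integral_testFunction {f : ℝ → ℂ} (hf : Integrable f intervalMeasure)
    (h : ∀ φ, IsTestFunction φ → ∫ x, (φ x : ℂ) * f x ∂intervalMeasure = 0) :
    f =ᵐ[intervalMeasure] 0 := by
  have hf' : IntegrableOn f (Icc 0 1) volume := hf
  have key := isOpen_Ioo.ae_eq_zero_of_integral_contDiff_smul_eq_zero (μ := volume)
    (U := Ioo (0 : ℝ) 1) (f := f) (hf'.mono_set Ioo_subset_Icc_self).locallyIntegrableOn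
    (fun φ h1 h2 h3 => by
      rw [← h φ ⟨h1, h2, h3⟩]
      simp only [Complex.real_smul]
      refine (setIntegral_eq_integral_of_forall_compl_eq_zero fun x hx => ?_).symm
      have : φ x = 0 := image_eq_zero_of_notMem_tsupport fun hx' => hx (Ioo_subset_Icc_self (h3 hx'))
      simp [this])
  have h4 : ∀ᵐ x ∂(volume.restrict (Ioo (0 : ℝ) 1)), f x = 0 :=
    (ae_restrict_iff' measurableSet_Ioo).2 key
  rw [restrict_Ioo_eq_restrict_Icc] at h4
  exact h4

lemma inner_contL2 {φ : ℝ → ℝ} (hφ : IsTestFunction φ) (f : L2Interval) :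
    ⟪contL2 _ hφ.continuous_ofReal, f⟫_ℂ = ∫ x, (φ x : ℂ) * f x ∂intervalMeasure := by
  rw [L2.inner_def]
  refine integral_congr_ae ?_
  filter_upwards [coeFn_contL2 hφ.continuous_ofReal] with x hx
  rw [hx]
  simp [mul_comm]

lemma eq_zero_of_inner_testFunction {f : L2Interval}
    (h : ∀ (φ : ℝ → ℝ) (hφ : IsTestFunction φ), ⟪contL2 _ hφ.continuous_ofReal, f⟫_ℂ = 0) :
    f = 0 := by
  rw [Lp.eq_zero_iff_ae_eq_zero]
  refine ae_eq_zero_of_integral_testFunction ((Lp.memLp f).integrable (by norm_num))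
    fun φ hφ => ?_
  rw [← inner_contL2 hφ, h φ hφ]

/-- The orthogonal complement is trivial by the fundamental lemma of the calculus of variations. -/
lemma testSpan_topologicalClosure : testSpan.topologicalClosure = ⊤ := by
  rw [Submodule.topologicalClosure_eq_top_iff, eq_bot_iff]
  intro f hf
  refine eq_zero_of_inner_testFunction fun φ hφ => ?_
  exact (Submodule.mem_orthogonal _ _).1 hf _ (Submodule.subset_span ⟨φ, hφ, rfl⟩)

/-! ### The spectrum of a diagonal operator with affine multipliers -/

open scoped Pointwise in
/-- The spectrum of the operator acting as multiplication by `γ x + δ n` on the `n`-th summand. -/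
lemma unboundedSpectrum_diagOp_affineMul {E : Type*} [NormedAddCommGroup E]
    [InnerProductSpace ℂ E] (W : E ≃ₗᵢ[ℂ] lp (fun _ : ℤ => L2Interval) 2) (γ : ℂ) (δ : ℤ → ℂ)
    (hcl : IsClosed (range δ)) :
    unboundedSpectrum (diagOp W fun n => affineMul γ (δ n)) =
      {z | ∃ x ∈ Icc (0 : ℝ) 1, ∃ n, z = γ * x + δ n} := by
  ext μ
  constructor
  · intro hμ
    by_contra hn
    refine hμ ?_
    have hc : IsCompact ((fun x : ℝ => γ * x) '' Icc 0 1) :=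
      isCompact_Icc.image (by fun_prop)
    -- Compact plus closed is closed, so a point `μ` outside has a distance `ε` from all multiplier
    -- values simultaneously. This bounds the fibre inverses by `ε⁻¹` uniformly in `n`.
    have h1 : IsClosed ((fun x : ℝ => γ * x) '' Icc 0 1 + range δ) := hcl.add_left_of_isCompact hc
    have h2 : μ ∉ (fun x : ℝ => γ * x) '' Icc 0 1 + range δ := by
      rintro ⟨_, ⟨x, hx, rfl⟩, _, ⟨n, rfl⟩, rfl⟩
      exact hn ⟨x, hx, n, rfl⟩
    obtain ⟨ε, hε, hb⟩ := Metric.isOpen_iff.1 h1.isOpen_compl μ h2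
    have h3 : ∀ n, ∀ x ∈ Icc (0 : ℝ) 1, ε ≤ ‖γ * x + δ n - μ‖ := fun n x hx => by
      by_contra hlt
      refine hb (a := γ * x + δ n) ?_ ⟨_, ⟨x, hx, rfl⟩, _, ⟨n, rfl⟩, rfl⟩
      rw [Metric.mem_ball, dist_eq_norm]
      exact not_le.1 hlt
    choose B hB hB1 hB2 using fun n => exists_inverse_affineMul γ (δ n) μ hε (h3 n)
    exact inResolventSet_diagOp W _ (inv_nonneg.2 hε.le) B hB hB1 hB2
  · rintro ⟨x, hx, n, rfl⟩
    exact not_inResolventSet_diagOp W _ n fun ε hε => exists_approx_eigenvector γ (δ n) hx hε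

lemma isClosed_range_intCast_mul {c : ℂ} (hc : c ≠ 0) : IsClosed (range fun n : ℤ => (n : ℂ) * c) := by
  have h1 : IsClosed (range ((↑) : ℤ → ℂ)) := by
    have h2 := (Complex.isometry_ofReal.isClosedEmbedding.comp Int.isClosedEmbedding_coe_real).isClosed_range
    convert h2 using 2
    ext n
    simp
  have h3 := (Homeomorph.mulRight₀ c hc).isClosedMap _ h1
  rw [← range_comp] at h3
  exact h3

end TorusQuantisation

namespace TorusQuantisation

/-! ### The fibrewise Fourier decomposition of `L²([0,1]²)` -/

lemma squareMeasure_eq_prod : squareMeasure = intervalMeasure.prod intervalMeasure := by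
  rw [Measure.prod_restrict, ← Measure.volume_eq_prod]

instance : IsProbabilityMeasure squareMeasure := by
  rw [squareMeasure_eq_prod]; infer_instance

lemma ae_mem_square : ∀ᵐ x ∂squareMeasure, x ∈ Icc (0 : ℝ) 1 ×ˢ Icc (0 : ℝ) 1 :=
  ae_restrict_mem (measurableSet_Icc.prod measurableSet_Icc)

lemma measurePreserving_fst_square :
    MeasurePreserving Prod.fst squareMeasure intervalMeasure := by
  rw [squareMeasure_eq_prod]; exact measurePreserving_fst

/-- The quasi-periodic Fourier modes `e^{(2πin - iπκu')v'}`. -/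
noncomputable def mode (κ n : ℤ) (x : ℝ × ℝ) : ℂ :=
  exp (((2 * Real.pi * n - Real.pi * κ * x.1) * x.2 : ℝ) * I)

lemma norm_mode (κ n : ℤ) (x : ℝ × ℝ) : ‖mode κ n x‖ = 1 := norm_exp_ofReal_mul_I _

lemma contDiff_mode (κ n : ℤ) : ContDiff ℝ ∞ (mode κ n) := by
  unfold mode
  have h : ContDiff ℝ ∞ fun x : ℝ × ℝ => (2 * Real.pi * n - Real.pi * κ * x.1) * x.2 := by fun_prop
  exact ((ofRealCLM.contDiff.comp h).mul contDiff_const).cexp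

lemma conj_mode (κ n : ℤ) (x : ℝ × ℝ) : starRingEnd ℂ (mode κ n x) = mode (-κ) (-n) x := by
  rw [mode, mode, ← exp_conj, map_mul, conj_ofReal, conj_I]
  congr 1
  push_cast
  ring

lemma measurable_mode (κ n : ℤ) : Measurable (mode κ n) :=
  (contDiff_mode κ n).continuous.measurable

/-- Multiplication by a quasi-periodic Fourier mode. -/
noncomputable def modeMul (κ n : ℤ) : L2Square →L[ℂ] L2Square :=
  boundedMul (mode κ n) (measurable_mode κ n) 1 (.of_forall fun x => (norm_mode κ n x).le)

/-- The isometric embedding `a ↦ a(u') e^{(2πin - iπκu')v'}` of `L²([0,1])` into `L²([0,1]²)`. -/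
noncomputable def modeIsometry (κ n : ℤ) : L2Interval →ₗᵢ[ℂ] L2Square where
  toLinearMap := (modeMul κ n).toLinearMap ∘ₗ
    (Lp.compMeasurePreservingₗᵢ ℂ Prod.fst measurePreserving_fst_square).toLinearMap
  norm_map' f := by
    change ‖modeMul κ n (Lp.compMeasurePreservingₗᵢ ℂ Prod.fst measurePreserving_fst_square f)‖ = _
    rw [modeMul, norm_boundedMul_of_norm_eq_one _ _ (norm_mode κ n), LinearIsometry.norm_map]

lemma coeFn_modeIsometry (κ n : ℤ) (a : L2Interval) :
    modeIsometry κ n a =ᵐ[squareMeasure] fun x => mode κ n x * a x.1 := by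
  have h1 := coeFn_boundedMul (ν := squareMeasure) (measurable_mode κ n)
    (.of_forall fun x => (norm_mode κ n x).le)
    (Lp.compMeasurePreservingₗᵢ ℂ Prod.fst measurePreserving_fst_square a)
  have h2 := Lp.coeFn_compMeasurePreserving a measurePreserving_fst_square
  filter_upwards [h1, h2] with x h3 h4
  refine h3.trans ?_
  rw [← Function.comp_apply (f := a), ← h4]
  rfl

lemma integral_mode_interval {m n : ℤ} (h : m ≠ n) :
    ∫ v, exp (2 * Real.pi * I * ((n : ℂ) - m) * v) ∂intervalMeasure = 0 := by
  have h0 : (2 * Real.pi * I * ((n : ℂ) - m)) ≠ 0 := by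
    have : ((n : ℂ) - m) ≠ 0 := sub_ne_zero.2 (by exact_mod_cast h.symm)
    simp [this, Real.pi_ne_zero]
  rw [integral_Icc_eq_integral_Ioc, ← intervalIntegral.integral_of_le zero_le_one,
    integral_exp_mul_complex h0]
  have h1 : exp (2 * Real.pi * I * ((n : ℂ) - m) * (1 : ℝ)) = 1 := by
    rw [← exp_int_mul_two_pi_mul_I (n - m)]
    congr 1
    push_cast
    ring
  rw [h1]
  simp

/-- The twist `e^{-iπκu'v'}` is common to both modes and unimodular, so it cancels. By Fubini what
remains is the orthogonality of ordinary exponentials in `v'`. -/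
lemma inner_modeIsometry_of_ne (κ : ℤ) {m n : ℤ} (h : m ≠ n) (a c : L2Interval) :
    ⟪modeIsometry κ m a, modeIsometry κ n c⟫_ℂ = 0 := by
  have h1 : ⟪modeIsometry κ m a, modeIsometry κ n c⟫_ℂ = ∫ x : ℝ × ℝ,
      (starRingEnd ℂ (a x.1) * c x.1) * exp (2 * Real.pi * I * ((n : ℂ) - m) * x.2)
        ∂squareMeasure := by
    rw [L2.inner_def]
    refine integral_congr_ae ?_
    filter_upwards [coeFn_modeIsometry κ m a, coeFn_modeIsometry κ n c] with x h1 h2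
    rw [h1, h2, RCLike.inner_apply, map_mul, conj_mode]
    have h3 : mode κ n x * mode (-κ) (-m) x = exp (2 * Real.pi * I * ((n : ℂ) - m) * x.2) := by
      rw [mode, mode, ← exp_add]
      congr 1
      push_cast
      ring
    rw [← h3]
    ring
  rw [h1, squareMeasure_eq_prod,
    integral_prod_mul (fun u => starRingEnd ℂ (a u) * c u)
      (fun v : ℝ => exp (2 * Real.pi * I * ((n : ℂ) - m) * v)), integral_mode_interval h, mul_zero]

/-- A square integrable function on `[0,1]` with vanishing Fourier coefficients vanishes. -/
lemma ae_eq_zero_of_fourier_eq_zero {f : ℝ → ℂ} (hf : MemLp f 2 intervalMeasure)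
    (h : ∀ n : ℤ, ∫ v, exp (-(2 * Real.pi * I * n * v)) * f v ∂intervalMeasure = 0) :
    f =ᵐ[intervalMeasure] 0 := by
  have hf' : MemLp f 2 (volume.restrict (Ioc (0 : ℝ) 1)) := by
    rwa [restrict_Ioc_eq_restrict_Icc]
  have h0 : ∀ n, fourierCoeffOn zero_lt_one f n = 0 := fun n => by
    rw [fourierCoeffOn_eq_integral, intervalIntegral.integral_of_le zero_le_one,
      ← integral_Icc_eq_integral_Ioc]
    have h1 : ∀ v : ℝ, fourier (-n) (v : AddCircle ((1 : ℝ) - 0)) • f v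
        = exp (-(2 * Real.pi * I * n * v)) * f v := fun v => by
      rw [fourier_coe_apply, smul_eq_mul]
      congr 2
      push_cast
      ring
    simp_rw [h1]
    rw [h n, smul_zero]
  -- Parseval: the integral of `‖f‖²` is the sum of the squared coefficients, here zero.
  have h2 := hasSum_sq_fourierCoeffOn zero_lt_one hf'
  simp only [h0, norm_zero, ne_eq, OfNat.ofNat_ne_zero, not_false_eq_true, zero_pow, sub_zero,
    inv_one, one_smul] at h2
  have h3 := h2.unique hasSum_zero
  rw [intervalIntegral.integral_of_le zero_le_one, ← integral_Icc_eq_integral_Ioc,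
    integral_eq_zero_iff_of_nonneg (fun _ => by positivity)
      ((memLp_two_iff_integrable_sq_norm hf.1).1 hf)] at h3
  filter_upwards [h3] with x hx
  simpa using hx

/-- Completeness of the modes. Testing in `u'` shows that for almost every `u` the function `v ↦
e^{iπκuv} s(u,v)` has vanishing Fourier coefficients, so it vanishes on almost every fibre. -/
lemma eq_zero_of_inner_modeIsometry (κ : ℤ) (s : L2Square)
    (h : ∀ n a, ⟪modeIsometry κ n a, s⟫_ℂ = 0) : s = 0 := by
  have hs : MemLp s 2 (intervalMeasure.prod intervalMeasure) := by
    rw [← squareMeasure_eq_prod]; exact Lp.memLp s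
  have hi : ∀ n, Integrable (fun x => mode (-κ) (-n) x * s x)
      (intervalMeasure.prod intervalMeasure) := fun n =>
    (hs.integrable (by norm_num)).bdd_mul (c := 1) (measurable_mode _ _).aestronglyMeasurable
      (.of_forall fun x => (norm_mode _ _ x).le)
  have h1 : ∀ n : ℤ, (fun u => ∫ v, mode (-κ) (-n) (u, v) * s (u, v) ∂intervalMeasure)
      =ᵐ[intervalMeasure] 0 := fun n => by
    refine ae_eq_zero_of_integral_testFunction (hi n).integral_prod_left fun φ hφ => ?_
    rw [← h n (contL2 _ hφ.continuous_ofReal), L2.inner_def]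
    have h2 : ∫ x, ⟪(modeIsometry κ n (contL2 _ hφ.continuous_ofReal)) x, s x⟫_ℂ ∂squareMeasure
        = ∫ x, (φ x.1 : ℂ) * (mode (-κ) (-n) x * s x) ∂(intervalMeasure.prod intervalMeasure) := by
      rw [← squareMeasure_eq_prod]
      refine integral_congr_ae ?_
      filter_upwards [coeFn_modeIsometry κ n (contL2 _ hφ.continuous_ofReal),
        measurePreserving_fst_square.quasiMeasurePreserving.ae (coeFn_contL2 hφ.continuous_ofReal)]
        with x h3 h4
      rw [h3, RCLike.inner_apply, map_mul, conj_mode, h4, conj_ofReal]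
      ring
    rw [h2, integral_prod]
    · simp_rw [integral_const_mul]
    · obtain ⟨C, hC⟩ := isCompact_Icc.exists_bound_of_continuousOn (s := Icc (0 : ℝ) 1)
        hφ.continuous_ofReal.continuousOn
      refine (hi n).bdd_mul (c := C)
        (hφ.continuous_ofReal.comp continuous_fst).aestronglyMeasurable ?_
      rw [← squareMeasure_eq_prod]
      filter_upwards [ae_mem_square] with x hx using hC _ hx.1
  have h5 : ∀ᵐ u ∂intervalMeasure, ∀ᵐ v ∂intervalMeasure, s (u, v) = 0 := by
    have hsq := (memLp_two_iff_integrable_sq_norm hs.1).1 hs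
    -- There are countably many `n`, so one null set of `u` serves all coefficients.
    filter_upwards [ae_all_iff.2 h1, hs.1.prodMk_left, hsq.prod_right_ae] with u hu hm hq
    have hu2 : MemLp (fun v => s (u, v)) 2 intervalMeasure :=
      (memLp_two_iff_integrable_sq_norm hm).2 hq
    have hu3 : MemLp (fun v => mode (-κ) 0 (u, v) * s (u, v)) 2 intervalMeasure := by
      refine hu2.of_le_mul (c := 1) (((measurable_mode (-κ) 0).comp
        measurable_prodMk_left).aestronglyMeasurable.mul hm) (.of_forall fun v => ?_)
      rw [norm_mul, norm_mode]
    have hu4 := ae_eq_zero_of_fourier_eq_zero hu3 fun n => by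
      have := hu n
      simp only [Pi.zero_apply] at this
      rw [← this]
      refine integral_congr_ae (.of_forall fun v => ?_)
      simp only [← mul_assoc]
      congr 1
      rw [mode, mode, ← exp_add]
      congr 1
      push_cast
      ring
    filter_upwards [hu4] with v hv
    have hne : mode (-κ) 0 (u, v) ≠ 0 := exp_ne_zero _
    simpa [hne] using hv
  rw [Lp.eq_zero_iff_ae_eq_zero]
  have h6 : ∀ᵐ x ∂(intervalMeasure.prod intervalMeasure), s x = 0 := by
    have hm := hs.1.norm.aemeasurable
    -- Passing from fibrewise to joint vanishing needs a measurable zero set, hence the strongly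
    -- measurable representative of `s`.
    have h7 := (Measure.ae_prod_iff_ae_ae (μ := intervalMeasure) (ν := intervalMeasure)
      (p := fun x => (hs.1.mk s) x = 0)
      (hs.1.stronglyMeasurable_mk.measurable (measurableSet_singleton 0)))
    have h8 := Measure.ae_ae_of_ae_prod hs.1.ae_eq_mk
    have h9 : ∀ᵐ x ∂(intervalMeasure.prod intervalMeasure), (hs.1.mk s) x = 0 := by
      rw [h7]
      filter_upwards [h5, h8] with u hu hu'
      filter_upwards [hu, hu'] with v hv hv'
      rw [← hv', hv]
    filter_upwards [hs.1.ae_eq_mk, h9] with x hx hx'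
    rw [hx, hx']
  rw [← squareMeasure_eq_prod] at h6
  exact h6

lemma isHilbertSum_modeIsometry (κ : ℤ) :
    IsHilbertSum ℂ (fun _ : ℤ => L2Interval) (modeIsometry κ) := by
  refine IsHilbertSum.mk (fun m n h a c => inner_modeIsometry_of_ne κ h a c) (top_le_iff.2 ?_)
  rw [Submodule.topologicalClosure_eq_top_iff, eq_bot_iff]
  intro s hs
  refine eq_zero_of_inner_modeIsometry κ s fun n a => ?_
  refine (Submodule.mem_orthogonal _ _).1 hs _ ?_
  exact Submodule.mem_iSup_of_mem n ⟨a, rfl⟩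

/-- The fibrewise Fourier transform. -/
noncomputable def modeTransform (κ : ℤ) : L2Square ≃ₗᵢ[ℂ] lp (fun _ : ℤ => L2Interval) 2 :=
  (isHilbertSum_modeIsometry κ).linearIsometryEquiv

lemma modeTransform_symm_single (κ n : ℤ) (a : L2Interval) :
    (modeTransform κ).symm (lp.single 2 n a) = modeIsometry κ n a :=
  (isHilbertSum_modeIsometry κ).linearIsometryEquiv_symm_apply_single a

lemma inner_modeIsometry (κ n : ℤ) (a : L2Interval) (s : L2Square) :
    ⟪modeIsometry κ n a, s⟫_ℂ = ⟪a, modeTransform κ s n⟫_ℂ := by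
  rw [← modeTransform_symm_single, inner_single_coord]

end TorusQuantisation

namespace TorusQuantisation

/-! ### Green's formula for smooth functions -/

lemma Icc_zero_one_prod : Icc ((0 : ℝ), (0 : ℝ)) (1, 1) = Icc (0 : ℝ) 1 ×ˢ Icc (0 : ℝ) 1 :=
  Icc_prod_eq _ _

lemma integral_interval_eq (f : ℝ → ℂ) :
    ∫ t, f t ∂intervalMeasure = ∫ t in (0 : ℝ)..1, f t := by
  rw [integral_Icc_eq_integral_Ioc, intervalIntegral.integral_of_le zero_le_one]

lemma continuous_fderiv_apply {F : ℝ × ℝ → ℂ} (hF : ContDiff ℝ ∞ F) (e : ℝ × ℝ) :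
    Continuous fun x => fderiv ℝ F x e :=
  (hF.continuous_fderiv (by simp)).clm_apply continuous_const

/-- The divergence theorem for the vector field `(F, 0)`. -/
lemma integral_fderiv_fst {F : ℝ × ℝ → ℂ} (hF : ContDiff ℝ ∞ F) :
    ∫ x, fderiv ℝ F x (1, 0) ∂squareMeasure
      = ∫ t, F (1, t) ∂intervalMeasure - ∫ t, F (0, t) ∂intervalMeasure := by
  have hd : Differentiable ℝ F := hF.differentiable (by simp)
  have h := integral_divergence_prod_Icc_of_hasFDerivAt_of_le F 0 (fderiv ℝ F) 0 (0, 0) (1, 1)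
    (by simp) hF.continuous.continuousOn continuousOn_const
    (fun x _ => (hd x).hasFDerivAt) (fun x _ => hasFDerivAt_const _ _) (by
      simp only [Pi.zero_apply, zero_apply, add_zero]
      rw [Icc_zero_one_prod]
      exact (continuous_fderiv_apply hF _).continuousOn.integrableOn_compact
        (isCompact_Icc.prod isCompact_Icc))
  have hm : squareMeasure = volume.restrict (Icc ((0 : ℝ), (0 : ℝ)) (1, 1)) := by
    rw [Icc_zero_one_prod]
  rw [hm]
  simpa [integral_interval_eq] using h

lemma integral_fderiv_snd {F : ℝ × ℝ → ℂ} (hF : ContDiff ℝ ∞ F) :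
    ∫ x, fderiv ℝ F x (0, 1) ∂squareMeasure
      = ∫ t, F (t, 1) ∂intervalMeasure - ∫ t, F (t, 0) ∂intervalMeasure := by
  have hd : Differentiable ℝ F := hF.differentiable (by simp)
  have h := integral_divergence_prod_Icc_of_hasFDerivAt_of_le 0 F 0 (fderiv ℝ F) (0, 0) (1, 1)
    (by simp) continuousOn_const hF.continuous.continuousOn
    (fun x _ => hasFDerivAt_const _ _) (fun x _ => (hd x).hasFDerivAt) (by
      simp only [Pi.zero_apply, zero_apply, zero_add]
      rw [Icc_zero_one_prod]
      exact (continuous_fderiv_apply hF _).continuousOn.integrableOn_compact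
        (isCompact_Icc.prod isCompact_Icc))
  have hm : squareMeasure = volume.restrict (Icc ((0 : ℝ), (0 : ℝ)) (1, 1)) := by
    rw [Icc_zero_one_prod]
  rw [hm]
  simpa [integral_interval_eq] using h

lemma memLp_square_of_continuous {F : ℝ × ℝ → ℂ} (hF : Continuous F) :
    MemLp F 2 squareMeasure := by
  obtain ⟨C, hC⟩ := (isCompact_Icc.prod isCompact_Icc :
    IsCompact (Icc (0 : ℝ) 1 ×ˢ Icc (0 : ℝ) 1)).exists_bound_of_continuousOn hF.continuousOn
  refine MemLp.of_bound hF.aestronglyMeasurable C ?_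
  filter_upwards [ae_mem_square] with x hx using hC x hx

/-- The element of `L²([0,1]²)` given by a continuous function. -/
noncomputable def contSquare (F : ℝ × ℝ → ℂ) (hF : Continuous F) : L2Square :=
  (memLp_square_of_continuous hF).toLp

lemma coeFn_contSquare {F : ℝ × ℝ → ℂ} (hF : Continuous F) :
    contSquare F hF =ᵐ[squareMeasure] F := MemLp.coeFn_toLp _

section Green

variable {e : ℝ × ℝ} {a c : ℝ → ℝ × ℝ}

/-- The product rule for `φ F`, integrated. The hypothesis `hG` abstracts the divergence theorem so
that both coordinate directions are covered at once. -/
lemma green_contSquare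
    (hG : ∀ F : ℝ × ℝ → ℂ, ContDiff ℝ ∞ F → ∫ x, fderiv ℝ F x e ∂squareMeasure
      = ∫ t, F (c t) ∂intervalMeasure - ∫ t, F (a t) ∂intervalMeasure)
    (ha : Continuous a) (hc : Continuous c) {F : ℝ × ℝ → ℂ} (hF : ContDiff ℝ ∞ F)
    {φ : ℝ × ℝ → ℝ} (hφ : ContDiff ℝ ∞ φ) :
    ∫ x, fderiv ℝ φ x e • contSquare F hF.continuous x ∂squareMeasure
      + ∫ x, φ x • contSquare _ (continuous_fderiv_apply hF e) x ∂squareMeasure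
      = ∫ t, φ (c t) • contL2 _ (hF.continuous.comp hc) t ∂intervalMeasure
        - ∫ t, φ (a t) • contL2 _ (hF.continuous.comp ha) t ∂intervalMeasure := by
  rw [← integral_add (integrable_square (continuous_partial hφ e) _)
    (integrable_square hφ.continuous _)]
  have h1 := hG (fun x => φ x • F x) (hφ.smul hF)
  have hd : ∀ x, fderiv ℝ (fun x => φ x • F x) x e
      = fderiv ℝ φ x e • F x + φ x • fderiv ℝ F x e := fun x => by
    have h2 : HasFDerivAt (fun x => φ x • F x) _ x :=
      ((hφ.differentiable (by simp)) x).hasFDerivAt.smul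
        ((hF.differentiable (by simp)) x).hasFDerivAt
    rw [h2.fderiv]
    simp
    ring
  refine Eq.trans ?_ (h1.trans ?_)
  · refine integral_congr_ae ?_
    filter_upwards [coeFn_contSquare hF.continuous,
      coeFn_contSquare (continuous_fderiv_apply hF e)] with x h3 h4
    rw [h3, h4, hd]
  · congr 1
    · refine integral_congr_ae ?_
      filter_upwards [coeFn_contL2 (hF.continuous.comp hc)] with x h3
      rw [h3]
      rfl
    · refine integral_congr_ae ?_
      filter_upwards [coeFn_contL2 (hF.continuous.comp ha)] with x h3
      rw [h3]
      rfl

lemma isWeakPartial_contSquare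
    (hG : ∀ F : ℝ × ℝ → ℂ, ContDiff ℝ ∞ F → ∫ x, fderiv ℝ F x e ∂squareMeasure
      = ∫ t, F (c t) ∂intervalMeasure - ∫ t, F (a t) ∂intervalMeasure)
    (ha : Continuous a) (hc : Continuous c) (ha' : ∀ t, a t ∉ Ioo (0 : ℝ) 1 ×ˢ Ioo (0 : ℝ) 1)
    (hc' : ∀ t, c t ∉ Ioo (0 : ℝ) 1 ×ˢ Ioo (0 : ℝ) 1) {F : ℝ × ℝ → ℂ} (hF : ContDiff ℝ ∞ F) :
    IsWeakPartial e (contSquare F hF.continuous)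
      (contSquare _ (continuous_fderiv_apply hF e)) := by
  intro φ hφ _ hs
  have h0 : ∀ x, x ∉ Ioo (0 : ℝ) 1 ×ˢ Ioo (0 : ℝ) 1 → φ x = 0 := fun x hx =>
    image_eq_zero_of_notMem_tsupport fun hx' => hx (hs hx')
  have h := green_contSquare hG ha hc hF hφ
  simp only [h0 _ (ha' _), h0 _ (hc' _), zero_smul, integral_zero, sub_zero] at h
  exact eq_neg_of_add_eq_zero_left h

lemma hasTracesAlong_contSquare
    (hG : ∀ F : ℝ × ℝ → ℂ, ContDiff ℝ ∞ F → ∫ x, fderiv ℝ F x e ∂squareMeasure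
      = ∫ t, F (c t) ∂intervalMeasure - ∫ t, F (a t) ∂intervalMeasure)
    (ha : Continuous a) (hc : Continuous c) (ha' : ∀ t, a t ∉ Ioo (0 : ℝ) 1 ×ˢ Ioo (0 : ℝ) 1)
    (hc' : ∀ t, c t ∉ Ioo (0 : ℝ) 1 ×ˢ Ioo (0 : ℝ) 1) {F : ℝ × ℝ → ℂ} (hF : ContDiff ℝ ∞ F) :
    HasTracesAlong e a c (contSquare F hF.continuous) (contL2 _ (hF.continuous.comp ha))
      (contL2 _ (hF.continuous.comp hc)) :=
  ⟨_, isWeakPartial_contSquare hG ha hc ha' hc' hF, fun _ hφ => green_contSquare hG ha hc hF hφ⟩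

/-- Splitting an integral against a complex test function into real and imaginary parts. -/
lemma integral_mul_eq_re_add_im {X : Type*} [MeasurableSpace X] {ν : Measure X} {Ψ : X → ℂ}
    {f : X → ℂ} (hr : Integrable (fun x => (Ψ x).re • f x) ν)
    (hi : Integrable (fun x => (Ψ x).im • f x) ν) :
    ∫ x, Ψ x * f x ∂ν = ∫ x, (Ψ x).re • f x ∂ν + I * ∫ x, (Ψ x).im • f x ∂ν := by
  rw [← integral_const_mul, ← integral_add hr (hi.const_mul I)]
  refine integral_congr_ae (.of_forall fun x => ?_)
  simp only [real_smul]
  conv_lhs => rw [← re_add_im (Ψ x)]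
  ring

lemma IsWeakPartial.unique {f g g' : L2Square} (h : IsWeakPartial e f g)
    (h' : IsWeakPartial e f g') : g = g' :=
  sub_eq_zero.1 (weakPartialGraph_single_valued e (f - f, g - g')
    ((weakPartialGraph e).sub_mem (x := (f, g)) (y := (f, g')) h h') (sub_self f))

/-- Green's formula with complex test functions. -/
lemma HasTracesAlong.green_complex (ha : Continuous a) (hc : Continuous c) {f g : L2Square}
    {l r : L2Interval} (h : HasTracesAlong e a c f l r) (hg : IsWeakPartial e f g)
    {Φ : ℝ × ℝ → ℂ} (hΦ : ContDiff ℝ ∞ Φ) :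
    ∫ x, fderiv ℝ Φ x e * f x ∂squareMeasure + ∫ x, Φ x * g x ∂squareMeasure
      = ∫ t, Φ (c t) * r t ∂intervalMeasure - ∫ t, Φ (a t) * l t ∂intervalMeasure := by
  obtain ⟨g', hg', hG⟩ := h
  -- The trace relation carries its own weak derivative; uniqueness identifies it with `g`. The
  -- formula is then applied to the real and imaginary parts of `Φ`, as traces are tested on real
  -- functions only.
  obtain rfl := hg.unique hg'
  have hre : ContDiff ℝ ∞ fun x => (Φ x).re := reCLM.contDiff.comp hΦ
  have him : ContDiff ℝ ∞ fun x => (Φ x).im := imCLM.contDiff.comp hΦ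
  have h1 := hG _ hre
  have h2 := hG _ him
  have hd := fun x => (hΦ.differentiable (by simp) x).hasFDerivAt
  have h3 : ∀ x, fderiv ℝ (fun x => (Φ x).re) x e = (fderiv ℝ Φ x e).re := fun x => by
    have h5 : HasFDerivAt (fun x => (Φ x).re) (reCLM ∘L fderiv ℝ Φ x) x :=
      reCLM.hasFDerivAt.comp x (hd x)
    rw [h5.fderiv]; rfl
  have h4 : ∀ x, fderiv ℝ (fun x => (Φ x).im) x e = (fderiv ℝ Φ x e).im := fun x => by
    have h5 : HasFDerivAt (fun x => (Φ x).im) (imCLM ∘L fderiv ℝ Φ x) x :=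
      imCLM.hasFDerivAt.comp x (hd x)
    rw [h5.fderiv]; rfl
  simp only [h3] at h1
  simp only [h4] at h2
  have hc1 := continuous_fderiv_apply hΦ e
  rw [integral_mul_eq_re_add_im (integrable_square (continuous_re.comp hc1) f)
      (integrable_square (continuous_im.comp hc1) f),
    integral_mul_eq_re_add_im (integrable_square hre.continuous g)
      (integrable_square him.continuous g),
    integral_mul_eq_re_add_im (integrable_interval (hre.continuous.comp hc) r)
      (integrable_interval (him.continuous.comp hc) r),
    integral_mul_eq_re_add_im (integrable_interval (hre.continuous.comp ha) l)
      (integrable_interval (him.continuous.comp ha) l)]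
  linear_combination h1 + I * h2

end Green

/-! ### Fourier modes and the Sobolev domains -/

lemma inner_affineMul_conj (γ δ : ℂ) (a f : L2Interval) :
    ⟪affineMul (starRingEnd ℂ γ) (starRingEnd ℂ δ) a, f⟫_ℂ = ⟪a, affineMul γ δ f⟫_ℂ := by
  have h : ⟪coordMul a, f⟫_ℂ = ⟪a, coordMul f⟫_ℂ :=
    (ContinuousLinearMap.isSelfAdjoint_iff_isSymmetric.1 isSelfAdjoint_coordMul) a f
  rw [affineMul_apply, affineMul_apply, inner_add_left, inner_add_right, inner_smul_left,
    inner_smul_left, inner_smul_right, inner_smul_right, h, conj_conj, conj_conj]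

lemma mode_zero (κ n : ℤ) (t : ℝ) : mode κ n (t, 0) = 1 := by simp [mode]

/-- Since `e^{2πin} = 1`, the value at the top is exactly the phase demanded by the boundary
condition, whatever `n` is. -/
lemma mode_one (κ n : ℤ) (t : ℝ) : mode κ n (t, 1) = exp (-(Real.pi * I * κ * t)) := by
  rw [mode, ← mul_one (exp (-(Real.pi * I * κ * t))), ← exp_int_mul_two_pi_mul_I n, ← exp_add]
  congr 1
  push_cast
  ring

/-- A test function in the first variable times a Fourier mode. -/
noncomputable def testMode (φ : ℝ → ℝ) (κ n : ℤ) (x : ℝ × ℝ) : ℂ := φ x.1 * mode κ n x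

lemma IsTestFunction.contDiff_testMode {φ : ℝ → ℝ} (hφ : IsTestFunction φ) (κ n : ℤ) :
    ContDiff ℝ ∞ (testMode φ κ n) :=
  (ofRealCLM.contDiff.comp (hφ.contDiff.comp contDiff_fst)).mul (contDiff_mode κ n)

/-- On a vertical line `φ` is constant and the mode is an exponential, so `∂/∂v'` becomes
multiplication by a function affine in `u'`. -/
lemma IsTestFunction.fderiv_testMode {φ : ℝ → ℝ} (hφ : IsTestFunction φ) (κ n : ℤ) (x : ℝ × ℝ) :
    fderiv ℝ (testMode φ κ n) x (0, 1)
      = (-(Real.pi * I * κ) * x.1 + 2 * Real.pi * I * n) * testMode φ κ n x := by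
  have h1 := ((hφ.contDiff_testMode κ n).differentiable (by simp) x).hasFDerivAt
  have h2 : HasDerivAt (fun v : ℝ => (x.1, v)) (0, 1) x.2 :=
    (hasDerivAt_const _ _).prodMk (hasDerivAt_id _)
  have h3 := h1.comp_hasDerivAt x.2 h2
  have h4 : HasDerivAt (fun v : ℝ => testMode φ κ n (x.1, v))
      ((-(Real.pi * I * κ) * x.1 + 2 * Real.pi * I * n) * testMode φ κ n x) x.2 := by
    have h5 : HasDerivAt (fun v : ℝ => (((2 * Real.pi * n - Real.pi * κ * x.1) * v : ℝ) : ℂ) * I)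
        (((2 * Real.pi * n - Real.pi * κ * x.1 : ℝ) : ℂ) * I) x.2 := by
      have := (((hasDerivAt_id x.2).const_mul
        (2 * Real.pi * n - Real.pi * κ * x.1)).ofReal_comp).mul_const I
      simpa using this
    have h6 := h5.cexp.const_mul (φ x.1 : ℂ)
    refine h6.congr_deriv ?_
    rw [testMode, mode]
    push_cast
    ring
  exact h3.unique h4

lemma IsTestFunction.eq_zero {φ : ℝ → ℝ} (hφ : IsTestFunction φ) {x : ℝ} (hx : x ∉ Ioo (0 : ℝ) 1) :
    φ x = 0 := image_eq_zero_of_notMem_tsupport fun h => hx (hφ.tsupport_subset h)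

lemma modeIsometry_contL2 {φ : ℝ → ℝ} (hφ : IsTestFunction φ) (κ n : ℤ) :
    modeIsometry κ n (contL2 _ hφ.continuous_ofReal)
      = contSquare (testMode φ κ n) (hφ.contDiff_testMode κ n).continuous := by
  refine Lp.ext ?_
  filter_upwards [coeFn_modeIsometry κ n (contL2 _ hφ.continuous_ofReal),
    measurePreserving_fst_square.quasiMeasurePreserving.ae (coeFn_contL2 hφ.continuous_ofReal),
    coeFn_contSquare (hφ.contDiff_testMode κ n).continuous] with x h1 h2 h3
  rw [h1, h2, h3, testMode, mul_comm]

lemma modeIsometry_affineMul_contL2 {φ : ℝ → ℝ} (hφ : IsTestFunction φ) (κ n : ℤ) :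
    modeIsometry κ n (affineMul (-(Real.pi * I * κ)) (2 * Real.pi * I * n)
        (contL2 _ hφ.continuous_ofReal))
      = contSquare _ (continuous_fderiv_apply (hφ.contDiff_testMode κ n) (0, 1)) := by
  refine Lp.ext ?_
  filter_upwards [coeFn_modeIsometry κ n (affineMul (-(Real.pi * I * κ)) (2 * Real.pi * I * n)
        (contL2 _ hφ.continuous_ofReal)),
    measurePreserving_fst_square.quasiMeasurePreserving.ae (coeFn_contL2 hφ.continuous_ofReal),
    measurePreserving_fst_square.quasiMeasurePreserving.ae (coeFn_affineMul (-(Real.pi * I * κ))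
      (2 * Real.pi * I * n) (contL2 _ hφ.continuous_ofReal)),
    coeFn_contSquare (continuous_fderiv_apply (hφ.contDiff_testMode κ n) (0, 1))] with x h1 h2 h3 h4
  rw [h1, h3, h2, h4, hφ.fderiv_testMode, testMode]
  ring

lemma mem_weakPartial_domain {e : ℝ × ℝ} {f g : L2Square} (h : IsWeakPartial e f g) :
    f ∈ (weakPartial e).domain := ⟨(f, g), h, rfl⟩

lemma isWeakPartial_weakPartial {e : ℝ × ℝ} (f : (weakPartial e).domain) :
    IsWeakPartial e f (weakPartial e f) := by
  have h := (weakPartial e).mem_graph f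
  have h2 : (weakPartial e).graph = weakPartialGraph e :=
    Submodule.toLinearPMap_graph_eq _ (weakPartialGraph_single_valued e)
  rw [h2] at h
  exact h

lemma isWeakPartial_modeIsometry {φ : ℝ → ℝ} (hφ : IsTestFunction φ) (κ n : ℤ) :
    IsWeakPartial (0, 1) (modeIsometry κ n (contL2 _ hφ.continuous_ofReal))
      (modeIsometry κ n (affineMul (-(Real.pi * I * κ)) (2 * Real.pi * I * n)
        (contL2 _ hφ.continuous_ofReal))) := by
  rw [modeIsometry_affineMul_contL2 hφ, modeIsometry_contL2 hφ]
  exact isWeakPartial_contSquare (a := fun t => (t, 0)) (c := fun t => (t, 1))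
    (fun F hF => integral_fderiv_snd hF) (by fun_prop) (by fun_prop) (by simp) (by simp)
    (hφ.contDiff_testMode κ n)

lemma contL2_eq_zero {f : ℝ → ℂ} (hf : Continuous f) (h : ∀ t, f t = 0) : contL2 f hf = 0 := by
  rw [Lp.eq_zero_iff_ae_eq_zero]
  filter_upwards [coeFn_contL2 hf] with t ht
  rw [ht, h t]
  rfl

/-- Because `φ` vanishes at both endpoints, the left and right traces are zero and every condition
on those sides is trivial; the top and bottom condition is built into the mode. -/
lemma modeIsometry_mem_vanishingLeft {φ : ℝ → ℝ} (hφ : IsTestFunction φ) (κ n : ℤ) :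
    modeIsometry κ n (contL2 _ hφ.continuous_ofReal) ∈ vanishingLeft κ := by
  have hF := hφ.contDiff_testMode κ n
  have hU := hasTracesAlong_contSquare (a := fun t => (0, t)) (c := fun t => (1, t))
    (fun F hF => integral_fderiv_fst hF) (by fun_prop) (by fun_prop) (by simp) (by simp) hF
  have hV := hasTracesAlong_contSquare (a := fun t => (t, 0)) (c := fun t => (t, 1))
    (fun F hF => integral_fderiv_snd hF) (by fun_prop) (by fun_prop) (by simp) (by simp) hF
  have hl : ∀ t, (testMode φ κ n ∘ fun t => (0, t)) t = 0 := fun t => by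
    rw [Function.comp_apply, testMode, hφ.eq_zero (by simp)]; simp
  have hr : ∀ t, (testMode φ κ n ∘ fun t => (1, t)) t = 0 := fun t => by
    rw [Function.comp_apply, testMode, hφ.eq_zero (by simp)]; simp
  rw [contL2_eq_zero _ hl, contL2_eq_zero _ hr] at hU
  rw [modeIsometry_contL2 hφ]
  refine ⟨⟨⟨mem_weakPartial_domain hU.choose_spec.1, mem_weakPartial_domain hV.choose_spec.1⟩,
    ⟨0, 0, hU, ?_⟩, ⟨_, _, hV, ?_⟩⟩, 0, hU⟩
  · filter_upwards [Lp.coeFn_zero ℂ 2 intervalMeasure] with x hx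
    simp only [hx, Pi.zero_apply, mul_zero]
  · filter_upwards [coeFn_contL2 (hF.continuous.comp (by fun_prop : Continuous fun t : ℝ => (t, (0 : ℝ)))),
      coeFn_contL2 (hF.continuous.comp (by fun_prop : Continuous fun t : ℝ => (t, (1 : ℝ))))]
      with t h1 h2
    rw [h1, h2]
    rw [Function.comp_apply, Function.comp_apply, testMode, testMode, mode_one, mode_zero]
    ring

/-- The Fourier coefficients of the weak derivative of a quasi-periodic function. -/
lemma modeTransform_weakPartial {κ : ℤ} {s g : L2Square} (hs : s ∈ quasiPeriodicH1 κ)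
    (hg : IsWeakPartial (0, 1) s g) (n : ℤ) :
    modeTransform κ g n = affineMul (-(Real.pi * I * κ)) (2 * Real.pi * I * n)
      (modeTransform κ s n) := by
  obtain ⟨-, -, l, r, hlr, hq⟩ := hs
  rw [← sub_eq_zero]
  refine eq_zero_of_inner_testFunction fun φ hφ => ?_
  -- The indices `-κ`, `-n` give the complex conjugate of the mode, as the inner product requires.
  -- Its phase at the top cancels the quasi-periodicity factor of `s`, and its derivative changes
  -- the sign of the multiplier, which absorbs the minus sign of Green's formula.
  have hΦ := hφ.contDiff_testMode (-κ) (-n)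
  have hG := HasTracesAlong.green_complex (by fun_prop) (by fun_prop) hlr hg hΦ
  have hb : ∫ t, testMode φ (-κ) (-n) (t, 1) * r t ∂intervalMeasure
      = ∫ t, testMode φ (-κ) (-n) (t, 0) * l t ∂intervalMeasure := by
    refine integral_congr_ae ?_
    filter_upwards [hq] with t ht
    have h1 : exp (-(Real.pi * I * (-κ : ℤ) * t)) * exp (-(Real.pi * I * κ * t)) = 1 := by
      rw [← exp_add, ← exp_zero]
      congr 1
      push_cast
      ring
    rw [ht, testMode, testMode, mode_one, mode_zero]
    linear_combination (φ t : ℂ) * l t * h1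
  rw [hb, sub_self] at hG
  rw [inner_sub_right, sub_eq_zero, ← inner_modeIsometry, ← inner_affineMul_conj, ← inner_modeIsometry,
    modeIsometry_contL2 hφ, L2.inner_def, L2.inner_def]
  have hF := hφ.contDiff_testMode κ n
  have h1 : ∫ x, ⟪contSquare (testMode φ κ n) hF.continuous x, g x⟫_ℂ ∂squareMeasure
      = ∫ x, testMode φ (-κ) (-n) x * g x ∂squareMeasure := by
    refine integral_congr_ae ?_
    filter_upwards [coeFn_contSquare hF.continuous] with x h1
    rw [h1, RCLike.inner_apply, testMode, map_mul, conj_mode, conj_ofReal, testMode, mul_comm]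
  rw [h1, eq_neg_of_add_eq_zero_right hG, ← integral_neg]
  refine integral_congr_ae ?_
  filter_upwards [coeFn_modeIsometry κ n (affineMul (starRingEnd ℂ (-(Real.pi * I * κ)))
      (starRingEnd ℂ (2 * Real.pi * I * n)) (contL2 _ hφ.continuous_ofReal)),
    measurePreserving_fst_square.quasiMeasurePreserving.ae (coeFn_contL2 hφ.continuous_ofReal),
    measurePreserving_fst_square.quasiMeasurePreserving.ae (coeFn_affineMul
      (starRingEnd ℂ (-(Real.pi * I * κ)))
      (starRingEnd ℂ (2 * Real.pi * I * n)) (contL2 _ hφ.continuous_ofReal))] with x h2 h3 h4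
  rw [h2, h4, h3, hφ.fderiv_testMode, RCLike.inner_apply, testMode]
  simp only [map_mul, map_add, conj_conj, conj_mode, conj_ofReal]
  push_cast
  ring

lemma coeFn_mulU (s : L2Square) : mulU s =ᵐ[squareMeasure] fun x => (x.1 : ℂ) * s x :=
  by unfold mulU mulOp; dsimp only [LinearMap.coe_mk, AddHom.coe_mk]; exact MemLp.coeFn_toLp _

lemma coeFn_mulV (s : L2Square) : mulV s =ᵐ[squareMeasure] fun x => (x.2 : ℂ) * s x :=
  by unfold mulV mulOp; dsimp only [LinearMap.coe_mk, AddHom.coe_mk]; exact MemLp.coeFn_toLp _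

lemma modeIsometry_coordMul (κ n : ℤ) (a : L2Interval) :
    modeIsometry κ n (coordMul a) = mulU (modeIsometry κ n a) := by
  refine Lp.ext ?_
  filter_upwards [coeFn_modeIsometry κ n (coordMul a), coeFn_modeIsometry κ n a,
    coeFn_mulU (modeIsometry κ n a),
    measurePreserving_fst_square.quasiMeasurePreserving.ae (coeFn_coordMul a)] with x h1 h2 h3 h4
  rw [h1, h4, h3, h2]
  ring

/-- The modes embed functions of `u'` compatibly with multiplication by `u'`, which is symmetric;
duality transfers this to the coordinates. -/
lemma modeTransform_mulU (κ : ℤ) (s : L2Square) (n : ℤ) :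
    modeTransform κ (mulU s) n = coordMul (modeTransform κ s n) := by
  refine ext_inner_left ℂ fun a => ?_
  have h : ⟪coordMul a, modeTransform κ s n⟫_ℂ = ⟪a, coordMul (modeTransform κ s n)⟫_ℂ :=
    (ContinuousLinearMap.isSelfAdjoint_iff_isSymmetric.1 isSelfAdjoint_coordMul) _ _
  rw [← h, ← inner_modeIsometry, ← inner_modeIsometry, modeIsometry_coordMul, L2.inner_def,
    L2.inner_def]
  refine integral_congr_ae ?_
  filter_upwards [coeFn_mulU s, coeFn_mulU (modeIsometry κ n a)] with x h1 h2
  rw [h1, h2, RCLike.inner_apply, RCLike.inner_apply, map_mul, conj_ofReal]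
  ring

end TorusQuantisation

namespace TorusQuantisation

/-! ### Interchanging the two coordinates -/

lemma measurePreserving_swap_square :
    MeasurePreserving Prod.swap squareMeasure squareMeasure := by
  rw [squareMeasure_eq_prod]; exact Measure.measurePreserving_swap

lemma coeFn_compSwap (f : L2Square) :
    Lp.compMeasurePreserving Prod.swap measurePreserving_swap_square f
      =ᵐ[squareMeasure] fun x => f x.swap :=
  Lp.coeFn_compMeasurePreserving f measurePreserving_swap_square

/-- The unitary operator on `L²([0,1]²)` interchanging the two coordinates. -/
noncomputable def swapL2 : L2Square ≃ₗᵢ[ℂ] L2Square where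
  toLinearEquiv := LinearEquiv.ofInvolutive
    (Lp.compMeasurePreservingₗᵢ ℂ Prod.swap measurePreserving_swap_square).toLinearMap
    fun f => by
      refine Lp.ext ?_
      change ⇑(Lp.compMeasurePreserving Prod.swap measurePreserving_swap_square
        (Lp.compMeasurePreserving Prod.swap measurePreserving_swap_square f)) =ᵐ[squareMeasure] f
      filter_upwards [coeFn_compSwap (Lp.compMeasurePreserving Prod.swap
          measurePreserving_swap_square f),
        measurePreserving_swap_square.quasiMeasurePreserving.ae (coeFn_compSwap f)] with x h1 h2
      rw [h1, h2, Prod.swap_swap]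
  norm_map' f :=
    (Lp.compMeasurePreservingₗᵢ ℂ Prod.swap measurePreserving_swap_square).norm_map f

lemma coeFn_swapL2 (f : L2Square) : swapL2 f =ᵐ[squareMeasure] fun x => f x.swap :=
  coeFn_compSwap f

lemma swapL2_swapL2 (f : L2Square) : swapL2 (swapL2 f) = f := swapL2.symm_apply_apply f

lemma integral_swapL2 (Ψ : ℝ × ℝ → ℝ) (f : L2Square) :
    ∫ x, Ψ x • swapL2 f x ∂squareMeasure = ∫ x, Ψ x.swap • f x ∂squareMeasure := by
  have h := measurePreserving_swap_square.integral_comp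
    MeasurableEquiv.prodComm.measurableEmbedding (fun x => Ψ x.swap • f x)
  rw [← h]
  refine integral_congr_ae ?_
  filter_upwards [coeFn_swapL2 f] with x hx
  rw [hx, Prod.swap_swap]

lemma contDiff_comp_swap {φ : ℝ × ℝ → ℝ} (hφ : ContDiff ℝ ∞ φ) :
    ContDiff ℝ ∞ fun x : ℝ × ℝ => φ x.swap :=
  hφ.comp (contDiff_snd.prodMk contDiff_fst)

lemma fderiv_comp_swap {φ : ℝ × ℝ → ℝ} (hφ : ContDiff ℝ ∞ φ) (x e : ℝ × ℝ) :
    fderiv ℝ (fun x => φ x.swap) x e = fderiv ℝ φ x.swap e.swap := by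
  have h1 := (hφ.differentiable (by simp) x.swap).hasFDerivAt
  have h2 := h1.comp x (ContinuousLinearEquiv.prodComm ℝ ℝ ℝ).hasFDerivAt
  have h3 : HasFDerivAt (fun x => φ x.swap) _ x := h2
  rw [h3.fderiv]
  rfl

lemma IsWeakPartial.swap {e : ℝ × ℝ} {f g : L2Square} (h : IsWeakPartial e f g) :
    IsWeakPartial e.swap (swapL2 f) (swapL2 g) := by
  intro φ hφ hc hs
  rw [integral_swapL2, integral_swapL2]
  have h1 := h _ (contDiff_comp_swap hφ)
    (hc.comp_homeomorph (Homeomorph.prodComm ℝ ℝ)) (by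
      intro x hx
      have h2 : tsupport (φ ∘ Homeomorph.prodComm ℝ ℝ)
          = Homeomorph.prodComm ℝ ℝ ⁻¹' tsupport φ :=
        tsupport_comp_eq_preimage φ (Homeomorph.prodComm ℝ ℝ)
      have h3 : x ∈ Homeomorph.prodComm ℝ ℝ ⁻¹' tsupport φ := by
        rw [← h2]; exact hx
      have h4 := hs h3
      exact ⟨h4.2, h4.1⟩)
  simp only [fderiv_comp_swap hφ] at h1
  exact h1

lemma HasTracesAlong.swap {e : ℝ × ℝ} {a c : ℝ → ℝ × ℝ} {f : L2Square} {l r : L2Interval}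
    (h : HasTracesAlong e a c f l r) :
    HasTracesAlong e.swap (fun t => (a t).swap) (fun t => (c t).swap) (swapL2 f) l r := by
  obtain ⟨g, hg, hG⟩ := h
  refine ⟨_, hg.swap, fun φ hφ => ?_⟩
  have h1 := hG _ (contDiff_comp_swap hφ)
  simp only [fderiv_comp_swap hφ] at h1
  rw [integral_swapL2, integral_swapL2]
  exact h1

lemma HasTracesU.swap {f : L2Square} {l r : L2Interval} (h : HasTracesU f l r) :
    HasTracesV (swapL2 f) l r := HasTracesAlong.swap h

lemma HasTracesV.swap {f : L2Square} {l r : L2Interval} (h : HasTracesV f l r) :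
    HasTracesU (swapL2 f) l r := HasTracesAlong.swap h

/-- The swap exchanges the two boundary conditions, whose exponents have opposite signs; hence `κ`
becomes `-κ`. -/
lemma swapL2_mem_quasiPeriodicH1 {κ : ℤ} {s : L2Square} (h : s ∈ quasiPeriodicH1 κ) :
    swapL2 s ∈ quasiPeriodicH1 (-κ) := by
  obtain ⟨-, ⟨l, r, h1, h2⟩, ⟨l', r', h3, h4⟩⟩ := h
  refine ⟨⟨mem_weakPartial_domain h3.swap.choose_spec.1,
    mem_weakPartial_domain h1.swap.choose_spec.1⟩, ⟨l', r', h3.swap, ?_⟩, ⟨l, r, h1.swap, ?_⟩⟩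
  · filter_upwards [h4] with x hx
    rw [hx]
    congr 2
    push_cast
    ring
  · filter_upwards [h2] with x hx
    rw [hx]
    congr 2
    push_cast
    ring

lemma swapL2_mem_vanishingLeft {κ : ℤ} {s : L2Square} (h : s ∈ vanishingBottom κ) :
    swapL2 s ∈ vanishingLeft (-κ) :=
  ⟨swapL2_mem_quasiPeriodicH1 h.1, h.2.choose, h.2.choose_spec.swap⟩

lemma swapL2_mem_vanishingBottom {κ : ℤ} {s : L2Square} (h : s ∈ vanishingLeft (-κ)) :
    swapL2 s ∈ vanishingBottom κ := by
  refine ⟨?_, h.2.choose, h.2.choose_spec.swap⟩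
  have := swapL2_mem_quasiPeriodicH1 h.1
  rwa [neg_neg] at this

lemma swapL2_mulV (s : L2Square) : swapL2 (mulV s) = mulU (swapL2 s) := by
  refine Lp.ext ?_
  filter_upwards [coeFn_swapL2 (mulV s), coeFn_swapL2 s, coeFn_mulU (swapL2 s),
    measurePreserving_swap_square.quasiMeasurePreserving.ae (coeFn_mulV s)] with x h1 h2 h3 h4
  rw [h1, h4, h3, h2]
  rfl

/-! ### Diagonalisation of first order operators and of multiplication operators -/

/-- Reduces closure statements to test functions: the preimage of a closed subspace under `L` is
closed and contains the dense `testSpan`. -/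
lemma mem_topologicalClosure_of_testFunction {F : Type*} [NormedAddCommGroup F]
    [NormedSpace ℂ F] (L : L2Interval →L[ℂ] F) {S : Submodule ℂ F}
    (h : ∀ (φ : ℝ → ℝ) (hφ : IsTestFunction φ), L (contL2 _ hφ.continuous_ofReal) ∈ S)
    (a : L2Interval) : L a ∈ S.topologicalClosure := by
  have h1 : testSpan ≤ S.topologicalClosure.comap L.toLinearMap := by
    refine Submodule.span_le.2 ?_
    rintro _ ⟨φ, hφ, rfl⟩
    exact S.le_topologicalClosure (h φ hφ)
  have h2 := Submodule.topologicalClosure_minimal _ h1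
    (S.isClosed_topologicalClosure.preimage L.continuous)
  rw [testSpan_topologicalClosure] at h2
  exact h2 Submodule.mem_top

lemma dense_vanishingLeft (κ : ℤ) : Dense (vanishingLeft κ : Set L2Square) := by
  refine dense_of_single_mem (modeTransform κ) fun n a => ?_
  rw [modeTransform_symm_single]
  exact mem_topologicalClosure_of_testFunction (modeIsometry κ n).toContinuousLinearMap
    (fun φ hφ => modeIsometry_mem_vanishingLeft hφ κ n) a

lemma dense_vanishingBottom (κ : ℤ) : Dense (vanishingBottom κ : Set L2Square) := by
  have h := swapL2.surjective.denseRange.dense_image swapL2.continuous (dense_vanishingLeft (-κ))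
  refine h.mono ?_
  rintro _ ⟨s, hs, rfl⟩
  exact swapL2_mem_vanishingBottom hs

/-- Up to a unitary `U`, the operator `α ∂/∂v' + β u'` on quasi-periodic functions vanishing on the
left and right sides of the square is diagonalised by the fibrewise Fourier transform. -/
theorem isEssentiallyNormal_firstOrder (κ : ℤ) {α β : ℂ} (hα : α ≠ 0)
    (U : L2Square ≃ₗᵢ[ℂ] L2Square) {T : L2Square →ₗ.[ℂ] L2Square}
    (hdom : ∀ s, s ∈ T.domain ↔ U s ∈ vanishingLeft κ)
    (hT : ∀ s : T.domain, ∃ g, IsWeakPartial (0, 1) (U s) g ∧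
      U (T s) = α • g + β • mulU (U s)) :
    IsEssentiallyNormal T ∧ unboundedSpectrum T.closure =
      {z | ∃ x ∈ Icc (0 : ℝ) 1, ∃ n : ℤ,
        z = (β - α * (Real.pi * I * κ)) * x + n * (2 * Real.pi * I * α)} := by
  set γ : ℂ := β - α * (Real.pi * I * κ) with hγ
  set δ : ℤ → ℂ := fun n => n * (2 * Real.pi * I * α) with hδ
  set W := U.trans (modeTransform κ) with hW
  -- The fibre multiplier is `α` times the eigenvalue of `∂/∂v'` plus `β u'`; the twist contributes
  -- the extra `-απiκ` to the slope.
  have hA : ∀ (n : ℤ) (a : L2Interval), affineMul γ (δ n) a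
      = α • affineMul (-(Real.pi * I * κ)) (2 * Real.pi * I * n) a + β • coordMul a := by
    intro n a
    rw [affineMul_apply, affineMul_apply, hγ, hδ]
    module
  have hWs : ∀ n a, W.symm (lp.single 2 n a) = U.symm (modeIsometry κ n a) := fun n a => by
    rw [← modeTransform_symm_single]; rfl
  have h1 : ∀ s : T.domain, ∀ n, W (T s) n = affineMul γ (δ n) (W s n) := by
    intro s n
    obtain ⟨g, hg, he⟩ := hT s
    have h2 := modeTransform_weakPartial ((hdom s).1 s.2).1 hg n
    simp only [hW, LinearIsometryEquiv.trans_apply]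
    rw [he, map_add, map_smul, map_smul, lp.coeFn_add, lp.coeFn_smul, lp.coeFn_smul,
      Pi.add_apply, Pi.smul_apply, Pi.smul_apply, h2, modeTransform_mulU, hA]
  have h2 : ∀ n a, (W.symm (lp.single 2 n a), W.symm (lp.single 2 n (affineMul γ (δ n) a)))
      ∈ T.graph.topologicalClosure := by
    intro n a
    rw [hWs, hWs]
    let V : L2Interval →L[ℂ] L2Square := (U.symm.toContinuousLinearEquiv :
      L2Square →L[ℂ] L2Square) ∘L (modeIsometry κ n).toContinuousLinearMap
    -- On a fixed summand the operator is bounded, so the graph element depends continuously on `a`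
    -- and test functions suffice.
    refine mem_topologicalClosure_of_testFunction (V.prod (V ∘L affineMul γ (δ n)))
      (fun φ hφ => ?_) a
    have hm := modeIsometry_mem_vanishingLeft hφ κ n
    have hs : V (contL2 _ hφ.continuous_ofReal) ∈ T.domain := by
      rw [hdom]
      change U (U.symm (modeIsometry κ n _)) ∈ _
      rwa [U.apply_symm_apply]
    refine T.mem_graph_iff.2 ⟨⟨_, hs⟩, rfl, U.injective ?_⟩
    obtain ⟨g, hg, he⟩ := hT ⟨_, hs⟩
    have hUV : ∀ a, U (V a) = modeIsometry κ n a := fun a => U.apply_symm_apply _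
    rw [he]
    simp only [hUV] at hg ⊢
    rw [hg.unique (isWeakPartial_modeIsometry hφ κ n), ← modeIsometry_coordMul]
    change _ = U (V (affineMul γ (δ n) _))
    rw [hUV, hA, map_add, map_smul, map_smul]
  refine ⟨isEssentiallyNormal_of_diagonal W _ (fun n => isStarNormal_affineMul _ _) h1 h2, ?_⟩
  rw [(closure_eq_diagOp W _ h1 h2).2]
  refine unboundedSpectrum_diagOp_affineMul W γ δ (isClosed_range_intCast_mul ?_)
  simp [Real.pi_ne_zero, hα]

/-- Multiplication by `u'` as a bounded operator. -/
noncomputable def mulUL : L2Square →L[ℂ] L2Square :=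
  boundedMul (fun x => (x.1 : ℂ)) (by fun_prop) 1 (by
    filter_upwards [ae_mem_square] with x hx
    rw [Complex.norm_real, Real.norm_of_nonneg hx.1.1]
    exact hx.1.2)

lemma mulUL_apply (s : L2Square) : mulUL s = mulU s := by
  refine Lp.ext ?_
  filter_upwards [coeFn_mulU s, coeFn_boundedMul (ν := squareMeasure)
    (m := fun x : ℝ × ℝ => (x.1 : ℂ)) (by fun_prop) (C := 1) (by
    filter_upwards [ae_mem_square] with x hx
    rw [Complex.norm_real, Real.norm_of_nonneg hx.1.1]
    exact hx.1.2) s] with x h1 h2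
  rw [h1]
  exact h2

/-- Up to a unitary `U`, multiplication by `c u'` on a dense domain. -/
theorem isEssentiallyNormal_multiplication (c : ℂ) (U : L2Square ≃ₗᵢ[ℂ] L2Square)
    {T : L2Square →ₗ.[ℂ] L2Square} (hd : Dense (T.domain : Set L2Square))
    (hT : ∀ s : T.domain, U (T s) = c • mulU (U s)) :
    IsEssentiallyNormal T ∧ unboundedSpectrum T.closure =
      {z | ∃ x ∈ Icc (0 : ℝ) 1, z = c * x} := by
  -- The twist is irrelevant here: multiplication by `u'` is diagonal for every `κ`, with the same
  -- entry in each summand.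
  set W := U.trans (modeTransform 0) with hW
  have h1 : ∀ s : T.domain, ∀ n, W (T s) n = affineMul c 0 (W s n) := by
    intro s n
    simp only [hW, LinearIsometryEquiv.trans_apply]
    rw [hT, map_smul, lp.coeFn_smul, Pi.smul_apply, modeTransform_mulU, affineMul_apply,
      zero_smul, add_zero]
  let B : L2Square →L[ℂ] L2Square := (U.symm.toContinuousLinearEquiv :
      L2Square →L[ℂ] L2Square) ∘L (c • mulUL) ∘L
      (U.toContinuousLinearEquiv : L2Square →L[ℂ] L2Square)
  have hB : ∀ s, U (B s) = c • mulU (U s) := fun s => by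
    change U (U.symm (c • mulUL (U s))) = _
    rw [U.apply_symm_apply, mulUL_apply]
  -- `T` agrees with the bounded operator `B` on a dense subspace, so the closure of its graph
  -- contains the whole graph of `B`.
  have h3 : ∀ s, (s, B s) ∈ T.graph.topologicalClosure := by
    intro s
    have h4 : (T.domain : Set L2Square) ⊆
        (fun s => (s, B s)) ⁻¹' (T.graph.topologicalClosure : Set (L2Square × L2Square)) := by
      intro s hs
      refine T.graph.le_topologicalClosure (T.mem_graph_iff.2 ⟨⟨s, hs⟩, rfl, U.injective ?_⟩)
      rw [hT, hB]
    exact closure_minimal h4 (T.graph.isClosed_topologicalClosure.preimage (by fun_prop)) (hd s)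
  have h2 : ∀ n a, (W.symm (lp.single 2 n a), W.symm (lp.single 2 n (affineMul c 0 a)))
      ∈ T.graph.topologicalClosure := by
    intro n a
    have h5 := h3 (W.symm (lp.single 2 n a))
    convert h5 using 2
    refine ext_coord W fun m => ?_
    have h6 : W (B (W.symm (lp.single 2 n a))) m
        = affineMul c 0 (W (W.symm (lp.single 2 n a)) m) := by
      simp only [hW, LinearIsometryEquiv.trans_apply]
      rw [hB, map_smul, lp.coeFn_smul, Pi.smul_apply, modeTransform_mulU, affineMul_apply,
        zero_smul, add_zero]
    rw [h6, coord_single, coord_single]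
    split_ifs <;> simp
  refine ⟨isEssentiallyNormal_of_diagonal W _ (fun n => isStarNormal_affineMul _ _) h1 h2, ?_⟩
  rw [(closure_eq_diagOp W _ h1 h2).2,
    unboundedSpectrum_diagOp_affineMul W c (fun _ => 0) (by
      rw [range_const]; exact isClosed_singleton)]
  simp

/-! ### The prequantum operators -/

/-- `domRestrict` intersects with the natural domain of the expression, which asks only for a weak
derivative in `L²`; membership in `H¹` already provides it. -/
lemma domain_opQ (b : ℂ) (k : ℤ) : (opQ b k).domain = vanishingLeft k := by
  refine inf_eq_left.2 fun s hs => ?_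
  exact ⟨hs.1.1.2, hs.1.1.2⟩

lemma domain_opP (b : ℂ) (k : ℤ) : (opP b k).domain = vanishingLeft k := by
  refine inf_eq_left.2 fun s hs => ?_
  exact ⟨hs.1.1.1, hs.1.1.1⟩

lemma domain_opQtilde (b : ℂ) (k : ℤ) : (opQtilde b k).domain = vanishingBottom k := by
  refine inf_eq_left.2 fun s hs => ?_
  exact ⟨hs.1.1.1, hs.1.1.1⟩

lemma domain_opPtilde (b : ℂ) (k : ℤ) : (opPtilde b k).domain = vanishingBottom k := by
  refine inf_eq_left.2 fun s hs => ?_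
  exact ⟨hs.1.1.2, hs.1.1.2⟩

/-- The two multiples of `∇_{v'}` add up to `-2i/t`, and `ib · (-2i/t) = 1/(2πb)`. The connection
term `-iπk u'` then contributes `-ik/(2b)` to the coefficient of `u'`. -/
lemma opQ_apply {b : ℂ} (hb : b ≠ 0) (k : ℤ) (s : (opQ b k).domain) :
    ∃ g, IsWeakPartial (0, 1) s g ∧ opQ b k s
      = (1 / (2 * Real.pi * b)) • g + (I * b - I * k / (2 * b)) • mulU s := by
  have hs : (s : L2Square) ∈ (weakPartial (0, 1)).domain := s.2.2.1
  refine ⟨weakPartial (0, 1) ⟨s, hs⟩, isWeakPartial_weakPartial ⟨_, hs⟩, ?_⟩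
  have h : opQ b k s = (I * b) • ((mulU s + (-(I / tParam b)) •
      ((-(I * Real.pi * k)) • mulU s + weakPartial (0, 1) ⟨s, hs⟩))
      + I • ((-(1 / tParam b)) •
      ((-(I * Real.pi * k)) • mulU s + weakPartial (0, 1) ⟨s, hs⟩))) := rfl
  have ht : tParam b = 4 * Real.pi * b ^ 2 := rfl
  have hp : (Real.pi : ℂ) ≠ 0 := by simp [Real.pi_ne_zero]
  rw [h, ht]
  match_scalars
  · field_simp
    linear_combination 4 * (k : ℂ) * I_sq
  · field_simp
    linear_combination (-4) * I_sq

lemma opQtilde_apply {b : ℂ} (hb : b ≠ 0) (k : ℤ) (s : (opQtilde b k).domain) :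
    ∃ g, IsWeakPartial (1, 0) s g ∧ opQtilde b k s
      = (-(1 / (2 * Real.pi * starRingEnd ℂ b))) • g
        + (I * starRingEnd ℂ b - I * k / (2 * starRingEnd ℂ b)) • mulV s := by
  have hs : (s : L2Square) ∈ (weakPartial (1, 0)).domain := s.2.2.1
  refine ⟨weakPartial (1, 0) ⟨s, hs⟩, isWeakPartial_weakPartial ⟨_, hs⟩, ?_⟩
  have h : opQtilde b k s = (I * starRingEnd ℂ b) •
      ((mulV s + (I / starRingEnd ℂ (tParam b)) •
      ((I * Real.pi * k) • mulV s + weakPartial (1, 0) ⟨s, hs⟩))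
      + (-I) • ((-(1 / starRingEnd ℂ (tParam b))) •
      ((I * Real.pi * k) • mulV s + weakPartial (1, 0) ⟨s, hs⟩))) := rfl
  have ht : starRingEnd ℂ (tParam b) = 4 * Real.pi * (starRingEnd ℂ b) ^ 2 := by
    rw [tParam, map_mul, map_mul, map_pow, conj_ofReal, map_ofNat]
  have hp : (Real.pi : ℂ) ≠ 0 := by simp [Real.pi_ne_zero]
  have hb' : starRingEnd ℂ b ≠ 0 := by simpa using hb
  rw [h, ht]
  generalize starRingEnd ℂ b = c at hb' ⊢
  match_scalars
  · field_simp
    linear_combination 4 * (k : ℂ) * I_sq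
  · field_simp
    linear_combination 4 * I_sq

/-- The covariant derivatives cancel, since `i/t̄ + i · (-1/t̄) = 0`. -/
lemma opP_apply (b : ℂ) (k : ℤ) (s : (opP b k).domain) : opP b k s = (I * b) • mulV s := by
  have hs : (s : L2Square) ∈ (weakPartial (1, 0)).domain := s.2.2.1
  have h : opP b k s = (I * b) • ((mulV s + (I / starRingEnd ℂ (tParam b)) • nablaU k ⟨s, hs⟩)
      + I • ((-(1 / starRingEnd ℂ (tParam b))) • nablaU k ⟨s, hs⟩)) := rfl
  rw [h]
  module

lemma opPtilde_apply (b : ℂ) (k : ℤ) (s : (opPtilde b k).domain) :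
    opPtilde b k s = (-(I * starRingEnd ℂ b)) • mulU s := by
  have hs : (s : L2Square) ∈ (weakPartial (0, 1)).domain := s.2.2.1
  have h : opPtilde b k s = (-(I * starRingEnd ℂ b)) •
      ((mulU s + (-(I / tParam b)) • nablaV k ⟨s, hs⟩)
      + (-I) • ((-(1 / tParam b)) • nablaV k ⟨s, hs⟩)) := rfl
  rw [h]
  module

end TorusQuantisation

/-! ### The spectra of the four operators -/

namespace TorusQuantisation

/-- The slope `i(b - k/b)` collects `-ik/(2b)` twice: once from the connection, once from the twist
of the modes. -/
lemma spectrum_opQ {b : ℂ} (hb : b ≠ 0) (k : ℤ) :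
    IsEssentiallyNormal (opQ b k) ∧ unboundedSpectrum (opQ b k).closure =
      {z | ∃ x ∈ Icc (0 : ℝ) 1, ∃ n : ℤ, z = I * (b - b⁻¹ * k) * x + I * b⁻¹ * n} := by
  have hp : (Real.pi : ℂ) ≠ 0 := by simp [Real.pi_ne_zero]
  have h := isEssentiallyNormal_firstOrder k (α := 1 / (2 * Real.pi * b))
    (β := I * b - I * k / (2 * b)) (by simp [hb, Real.pi_ne_zero])
    (LinearIsometryEquiv.refl ℂ L2Square) (T := opQ b k)
    (fun s => by rw [domain_opQ]; rfl) (fun s => opQ_apply hb k s)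
  refine ⟨h.1, h.2.trans (Set.ext fun z => ?_)⟩
  refine exists_congr fun x => and_congr_right fun _ => exists_congr fun n => ?_
  refine Eq.congr_right ?_
  field_simp
  ring

lemma spectrum_opQtilde {b : ℂ} (hb : b ≠ 0) (k : ℤ) :
    IsEssentiallyNormal (opQtilde b k) ∧ unboundedSpectrum (opQtilde b k).closure =
      {z | ∃ x ∈ Icc (0 : ℝ) 1, ∃ n : ℤ, z = I * (starRingEnd ℂ b - (starRingEnd ℂ b)⁻¹ * k) * x
        + I * (starRingEnd ℂ b)⁻¹ * n} := by
  have hp : (Real.pi : ℂ) ≠ 0 := by simp [Real.pi_ne_zero]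
  have hb' : starRingEnd ℂ b ≠ 0 := by simpa using hb
  have h := isEssentiallyNormal_firstOrder (-k) (α := -(1 / (2 * Real.pi * starRingEnd ℂ b)))
    (β := I * starRingEnd ℂ b - I * k / (2 * starRingEnd ℂ b)) (by simp [hb, Real.pi_ne_zero])
    swapL2 (T := opQtilde b k)
    (fun s => by
      rw [domain_opQtilde]
      refine ⟨swapL2_mem_vanishingLeft, fun hs => ?_⟩
      rw [← swapL2_swapL2 s]
      exact swapL2_mem_vanishingBottom hs)
    (fun s => by
      obtain ⟨g, hg, he⟩ := opQtilde_apply hb k s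
      refine ⟨swapL2 g, hg.swap, ?_⟩
      rw [he, map_add, map_smul, map_smul, swapL2_mulV])
  refine ⟨h.1, h.2.trans (Set.ext fun z => ?_)⟩
  refine exists_congr fun x => and_congr_right fun _ => ?_
  -- The coefficient of the derivative in `q̃` is negative, so the `n`-th fibre is shifted by
  -- `-in/b̄`; replacing `n` by `-n` restores the stated form.
  refine (Equiv.neg ℤ).exists_congr fun n => Eq.congr_right ?_
  generalize starRingEnd ℂ b = c at hb' ⊢
  simp only [Equiv.neg_apply]
  push_cast
  field_simp
  ring

lemma spectrum_opP (b : ℂ) (k : ℤ) :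
    IsEssentiallyNormal (opP b k) ∧ unboundedSpectrum (opP b k).closure =
      {z | ∃ x ∈ Icc (0 : ℝ) 1, z = I * b * x} :=
  isEssentiallyNormal_multiplication (I * b) swapL2
    (by rw [domain_opP]; exact dense_vanishingLeft k)
    (fun s => by rw [opP_apply, map_smul, swapL2_mulV])

lemma spectrum_opPtilde (b : ℂ) (k : ℤ) :
    IsEssentiallyNormal (opPtilde b k) ∧ unboundedSpectrum (opPtilde b k).closure =
      {z | ∃ x ∈ Icc (0 : ℝ) 1, z = -(I * starRingEnd ℂ b * x)} := by
  have h := isEssentiallyNormal_multiplication (-(I * starRingEnd ℂ b))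
    (LinearIsometryEquiv.refl ℂ L2Square) (T := opPtilde b k)
    (by rw [domain_opPtilde]; exact dense_vanishingBottom k) (fun s => opPtilde_apply b k s)
  simpa only [neg_mul] using h

end TorusQuantisation

theorem mainTheorem11 (b : ℂ) (hb : b ≠ 0) (k : ℤ) (hk : (k : ℝ) = 2 * (b ^ 2).re) :
    -- the operator q
    (((TorusQuantisation.opQ b k).domain : Set TorusQuantisation.L2Square) =
        {s | s ∈ TorusQuantisation.quasiPeriodicH1 k ∧ ∃ r, TorusQuantisation.HasTracesU s 0 r} ∧
      IsEssentiallyNormal (TorusQuantisation.opQ b k) ∧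
      unboundedSpectrum (TorusQuantisation.opQ b k).closure =
        {z | ∃ x ∈ Icc (0 : ℝ) 1, ∃ n : ℤ, z = I * (b - b⁻¹ * k) * x + I * b⁻¹ * n}) ∧
    -- the operator q̃
    (((TorusQuantisation.opQtilde b k).domain : Set TorusQuantisation.L2Square) =
        {s | s ∈ TorusQuantisation.quasiPeriodicH1 k ∧ ∃ r, TorusQuantisation.HasTracesV s 0 r} ∧
      IsEssentiallyNormal (TorusQuantisation.opQtilde b k) ∧
      unboundedSpectrum (TorusQuantisation.opQtilde b k).closure =
        {z | ∃ x ∈ Icc (0 : ℝ) 1, ∃ n : ℤ,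
          z = I * (starRingEnd ℂ b - (starRingEnd ℂ b)⁻¹ * k) * x
            + I * (starRingEnd ℂ b)⁻¹ * n}) ∧
    -- the operator p
    (((TorusQuantisation.opP b k).domain : Set TorusQuantisation.L2Square) =
        {s | s ∈ TorusQuantisation.quasiPeriodicH1 k ∧ ∃ r, TorusQuantisation.HasTracesU s 0 r} ∧
      IsEssentiallyNormal (TorusQuantisation.opP b k) ∧
      unboundedSpectrum (TorusQuantisation.opP b k).closure =
        {z | ∃ x ∈ Icc (0 : ℝ) 1, z = I * b * x}) ∧
    -- the operator p̃
    (((TorusQuantisation.opPtilde b k).domain : Set TorusQuantisation.L2Square) =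
        {s | s ∈ TorusQuantisation.quasiPeriodicH1 k ∧ ∃ r, TorusQuantisation.HasTracesV s 0 r} ∧
      IsEssentiallyNormal (TorusQuantisation.opPtilde b k) ∧
      unboundedSpectrum (TorusQuantisation.opPtilde b k).closure =
        {z | ∃ x ∈ Icc (0 : ℝ) 1, z = -(I * starRingEnd ℂ b * x)}) := by
  refine ⟨⟨?_, TorusQuantisation.spectrum_opQ hb k⟩, ⟨?_, TorusQuantisation.spectrum_opQtilde hb k⟩,
    ⟨?_, TorusQuantisation.spectrum_opP b k⟩, ⟨?_, TorusQuantisation.spectrum_opPtilde b k⟩⟩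
  · rw [TorusQuantisation.domain_opQ]; rfl
  · rw [TorusQuantisation.domain_opQtilde]; rfl
  · rw [TorusQuantisation.domain_opP]; rfl
  · rw [TorusQuantisation.domain_opPtilde]; rfl
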